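/- Let $G=(V,E)$ be a simple undirected graph on $n$ vertices, where each undirected edge $\{u,v\}$ is treated as the two directed edges $(u,v)$ and $(v,u)$; let $E$ be the set of directed edges, $m=|E|=\sum_{v\in V} d(v)$, and assume $m\ge 1$. Each vertex carries an arbitrary fixed order on its neighbors. An algorithm accesses $G$ through vertex queries (return a uniformly random vertex), degree queries (return $d(v)$) and neighbor queries (return the $i$-th neighbor of $v$, or "fail" if $i>d(v)$). Let $U$ be the uniform distribution on $E$. There is a randomized algorithm (a fixed program on words of $O(\log(n/\varepsilon))$ bits, that is given $n$ and $\lceil 1/\varepsilon\rceil$, and is not given $m$) such that for all such graphs $G$, all neighbor orders and all $0<\varepsilon<1$ the following holds. (1) The algorithm halts with probability $1$, returns either an edge of $G$ or "fail", makes $O\big(\frac{n}{\sqrt{\varepsilon m}}\,\mathrm{polylog}(n)\big)$ queries in expectation, has a running time linear in the number of queries it makes, and returns an edge with probability at least $2/3$. The distribution $P$ on $E$ of the returned edge, conditioned on an edge being returned, is pointwise $\varepsilon$-close to uniform: $|P(e)-U(e)|\le\varepsilon\,U(e)$ for all $e\in E$. (2) For every function $w:E\to\mathbb{R}$, $$\big|\mathbb{E}_{e\sim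 P}[w(e)]-\mathbb{E}_{e\sim U}[w(e)]\big|\le\varepsilon\,\mathbb{E}_{e\sim U}\big[|w(e)|\big].$$ In particular, if $w$ is nonnegative (or nonpositive), then $$\big|\mathbb{E}_{e\sim P}[w(e)]-\mathbb{E}_{e\sim U}[w(e)]\big|\le\varepsilon\,\big|\mathbb{E}_{e\sim U}[w(e)]\big|.$$ The constants in the $O$-bounds and the polylogarithmic exponent are absolute. -/

import Mathlib

open scoped ENNReal

namespace EdgeSampling

/-! ### Distributions on a finite set -/

/-- The uniform distribution on a finite set. -/
noncomputable def unif (Ω : Type*) [Fintype Ω] : Ω → ℝ :=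
  fun _ => 1 / (Fintype.card Ω : ℝ)

/-- The expectation of `w` when its argument is drawn from `P`. -/
noncomputable def expect {Ω : Type*} [Fintype Ω] (P : Ω → ℝ) (w : Ω → ℝ) : ℝ :=
  ∑ x, P x * w x

/-- `P` is pointwise `ε`-close to `Q`. -/
def PointwiseClose {Ω : Type*} (ε : ℝ) (P Q : Ω → ℝ) : Prop :=
  ∀ x, |P x - Q x| ≤ ε * Q x

/-- The uniform distribution on `{0, …, k - 1}` (the point mass at `0` if `k = 0`). -/
noncomputable def uniformBelow : ℕ → PMF ℕ
  | 0 => PMF.pure 0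
  | k + 1 => (PMF.uniformOfFintype (Fin (k + 1))).map Fin.val

/-! ### Graphs with query access

The vertices are `Fin n`; the vertex `v` is handed to a program as the number `v`. -/

/-- A fixed, arbitrary order on the neighbours of each vertex: `nbr v i` is the `i`-th neighbour
of `v`, for `i = 0, …, d(v) - 1`. -/
abbrev NeighborOrder {n : ℕ} (G : SimpleGraph (Fin n)) [DecidableRel G.Adj] :=
  (v : Fin n) → Fin (G.degree v) ≃ G.neighborSet v

/-- Answer to a degree query (`0` if `v` is not the label of a vertex). -/
def degreeAnswer {n : ℕ} (G : SimpleGraph (Fin n)) [DecidableRel G.Adj] (v : ℕ) : ℕ :=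
  if hv : v < n then G.degree ⟨v, hv⟩ else 0

/-- Answer to the query for the `i`-th neighbour of `v`, counted from `0`. The number `n`, which
is not the label of a vertex, stands for the answer "fail". -/
def neighborAnswer {n : ℕ} (G : SimpleGraph (Fin n)) [DecidableRel G.Adj]
    (nbr : NeighborOrder G) (v i : ℕ) : ℕ :=
  if hv : v < n then
    if hi : i < G.degree ⟨v, hv⟩ then ((nbr ⟨v, hv⟩ ⟨i, hi⟩ : Fin n) : ℕ) else n
  else n

/-! ### Randomized programs with query access

Programs are finite and act on registers that hold bounded natural numbers (machine words). -/

/-- Arithmetic instructions: sum, truncated difference, product, integer quotient. -/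
inductive Op
  | add | sub | mul | div

/-- The result of an arithmetic instruction, before it is reduced to a machine word. -/
def Op.eval : Op → ℕ → ℕ → ℕ
  | .add, a, b => a + b
  | .sub, a, b => a - b
  | .mul, a, b => a * b
  | .div, a, b => a / b

/-- An operand is a register or a constant. -/
inductive Operand
  | reg (i : ℕ)
  | const (a : ℕ)

/-- The value of an operand. -/
def Operand.val (R : ℕ → ℕ) : Operand → ℕ
  | .reg i => R i
  | .const a => a

/-- Programs. -/
inductive Cmd
  /-- register `r` receives `op x y` -/
  | arith (r : ℕ) (op : Op) (x y : Operand)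
  /-- register `r` receives a uniformly random number in `{0, …, x - 1}` -/
  | rand (r : ℕ) (x : Operand)
  /-- vertex query: register `r` receives a uniformly random vertex -/
  | vertexQuery (r : ℕ)
  /-- degree query: register `r` receives the degree of the vertex `x` -/
  | degreeQuery (r : ℕ) (x : Operand)
  /-- neighbour query: register `r` receives the neighbour number `y` of the vertex `x` -/
  | neighborQuery (r : ℕ) (x y : Operand)
  /-- first `c`, then `d` -/
  | seq (c d : Cmd)
  /-- if `x < y` then `c` else `d` -/
  | ifLT (x y : Operand) (c d : Cmd)
  /-- while `x < y` do `c` -/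
  | whileLT (x y : Operand) (c : Cmd)
  /-- halt and return the pair `(x, y)` -/
  | ret (x y : Operand)
  /-- halt and return "fail" -/
  | fail

/-- What a program can return. -/
inductive Outcome
  | fail
  | pair (u v : ℕ)

/-- A configuration of a run: the code still to be executed, the registers, the number of queries
and of steps made so far, and the value returned, if the run has halted. -/
structure Config where
  code : List Cmd
  regs : ℕ → ℕ
  queries : ℕ
  steps : ℕ
  out : Option Outcome

/-- Write `a` into register `r`; words hold the numbers below `M`. -/
def Config.store (M : ℕ) (s : Config) (r a : ℕ) : Config :=
  { s with regs := Function.update s.regs r (a % M) }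

/-- Execute the command `c` in the configuration `s`. -/
noncomputable def exec {n : ℕ} (G : SimpleGraph (Fin n)) [DecidableRel G.Adj]
    (nbr : NeighborOrder G) (M : ℕ) (s : Config) : Cmd → PMF Config
  | .arith r op x y => PMF.pure (s.store M r (op.eval (x.val s.regs) (y.val s.regs)))
  | .rand r x => (uniformBelow (x.val s.regs)).map fun a => s.store M r a
  | .vertexQuery r =>
      (uniformBelow n).map fun a => { s with queries := s.queries + 1 }.store M r a
  | .degreeQuery r x =>
      PMF.pure ({ s with queries := s.queries + 1 }.store M r (degreeAnswer G (x.val s.regs)))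
  | .neighborQuery r x y =>
      PMF.pure ({ s with queries := s.queries + 1 }.store M r
        (neighborAnswer G nbr (x.val s.regs) (y.val s.regs)))
  | .seq c d => PMF.pure { s with code := c :: d :: s.code }
  | .ifLT x y c d =>
      PMF.pure { s with code := (if x.val s.regs < y.val s.regs then c else d) :: s.code }
  | .whileLT x y c =>
      PMF.pure (if x.val s.regs < y.val s.regs
        then { s with code := c :: .whileLT x y c :: s.code } else s)
  | .ret x y => PMF.pure { s with out := some (.pair (x.val s.regs) (y.val s.regs)) }
  | .fail => PMF.pure { s with out := some .fail }

/-- One step of a run: pop the next command and execute it, at unit cost. A run whose code is used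
up returns "fail"; a run that has halted stays as it is. -/
noncomputable def step {n : ℕ} (G : SimpleGraph (Fin n)) [DecidableRel G.Adj]
    (nbr : NeighborOrder G) (M : ℕ) (s : Config) : PMF Config :=
  match s.out, s.code with
  | some _, _ => PMF.pure s
  | none, [] => PMF.pure { s with steps := s.steps + 1, out := some .fail }
  | none, c :: K => exec G nbr M { s with code := K, steps := s.steps + 1 } c

/-- The initial configuration of `A` on input `(n, k)`: register `0` holds `n`, register `1`
holds `k`, and all others hold `0`. -/
def Config.init (A : Cmd) (n k : ℕ) : Config where
  code := [A]
  regs := fun i => if i = 0 then n else if i = 1 then k else 0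
  queries := 0
  steps := 0
  out := none

/-- An execution environment for programs on the graph `G`: the neighbour orders, the second input
`k` of the program (the first one is the number `n` of vertices) and the bound `M` on words. -/
structure Env {n : ℕ} (G : SimpleGraph (Fin n)) [DecidableRel G.Adj] where
  nbr : NeighborOrder G
  k : ℕ
  M : ℕ

/-- The environment of a run with accuracy parameter `ε`. The program is told the number `n` of
vertices and `k = ⌈1 / ε⌉`, and computes with numbers below `(n + k) ^ b`, that is, with words of
`O(log (n / ε))` bits. -/
noncomputable def env {n : ℕ} (G : SimpleGraph (Fin n)) [DecidableRel G.Adj]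
    (nbr : NeighborOrder G) (ε : ℝ) (b : ℕ) : Env G where
  nbr := nbr
  k := ⌈1 / ε⌉₊
  M := (n + ⌈1 / ε⌉₊) ^ b

section Run

variable {n : ℕ} {G : SimpleGraph (Fin n)} [DecidableRel G.Adj]

/-- The distribution of the configuration of `A` after `T` steps. -/
noncomputable def runFor (I : Env G) (A : Cmd) : ℕ → PMF Config
  | 0 => PMF.pure (Config.init A n I.k)
  | T + 1 => (runFor I A T).bind (step G I.nbr I.M)

/-- The probability that `A` halts and returns `o`. -/
noncomputable def outcomeProb (I : Env G) (A : Cmd) (o : Outcome) : ℝ≥0∞ :=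
  ⨆ T, ((runFor I A T).map Config.out) (some o)

/-- The expected number of queries made by `A`. -/
noncomputable def expectedQueries (I : Env G) (A : Cmd) : ℝ≥0∞ :=
  ⨆ T, ∑' s, runFor I A T s * (s.queries : ℝ≥0∞)

/-- The probability that `A` returns the (directed) edge `e`. -/
noncomputable def returnProb (I : Env G) (A : Cmd) (e : G.Dart) : ℝ :=
  (outcomeProb I A (.pair e.fst e.snd)).toReal

/-- The probability that `A` returns an edge. -/
noncomputable def successProb (I : Env G) (A : Cmd) : ℝ :=
  ∑ e : G.Dart, returnProb I A e

/-- The distribution on edges induced by `A`: the law of the returned edge, given that an edge is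
returned. -/
noncomputable def edgeDist (I : Env G) (A : Cmd) : G.Dart → ℝ :=
  fun e => returnProb I A e / successProb I A

end Run

end EdgeSampling

open scoped ENNReal

namespace EdgeSampling

/-! ### Uniform numbers -/

/-! An attempt with threshold `θ` picks a uniform vertex `u` and a uniform `i < θ`, and goes on if
`d(u) ≤ θ` and `u` has an `i`-th neighbour `v`. A fair coin then decides between returning `(u, v)`
and, if `d(v) > θ`, returning a uniform edge out of `v`. An edge leaving a light vertex (degree at
most `θ`) is returned with probability exactly `1 / (2nθ)`. An edge leaving a heavy vertex gets the
same value times the fraction of light neighbours of that vertex. At most `m / (θ + 1)` vertices are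
heavy, so this fraction is at least `1 - η` as soon as `m ≤ η (θ + 1) ^ 2` (`le_dartProb`).

The right threshold is about `√(m / ε)`, but `m` is unknown. So attempt `t` uses `θ = nLk / t`,
where `L = 256 * Nat.clog 2 n` and `k = min ⌈1/ε⌉ n²`: the thresholds start high, where attempts are
accurate but mostly fail, and sink. Up to attempt `T = goodTrials`, about `nL√k / (2√m)`, the
inequality `(θ + 1) ^ 2 ≥ 4km` holds (`four_mul_le_threshold_sq`), which gives bias `1 / (4k)`.
Attempt `t` succeeds with probability of order `mt / (n²Lk)`; summed up to `T` this is at least `3L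
/ 128` (`le_sum_of_goodTrials`), so all of them fail with probability at most `n⁻⁶`. Hence the late,
possibly biased attempts hardly matter (`firstSuccess_close`), and about `T` attempts are expected.
If `1/ε > n²`, every threshold in use is at least `n`, no vertex is heavy and there is no bias at
all.

The link to the program is the predicate `Spec`, a symbolic execution that tracks outcome law,
expected queries and an amortized step count in which every query pays for a fixed number of steps.
-/

theorem mem_support_uniformBelow {x a : ℕ} :
    a ∈ (uniformBelow x).support ↔ a < max x 1 := by
  cases x with
  | zero => simp [uniformBelow]
  | succ k =>
    simp only [uniformBelow, PMF.mem_support_map_iff, PMF.mem_support_uniformOfFintype]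
    constructor
    · rintro ⟨i, -, rfl⟩
      exact lt_max_of_lt_left i.2
    · intro h
      exact ⟨⟨a, by omega⟩, by simp, rfl⟩

theorem uniformBelow_bind_apply {α : Type*} {x : ℕ} (hx : 0 < x) (f : ℕ → PMF α) (y : α) :
    ((uniformBelow x).bind f) y = (x : ℝ≥0∞)⁻¹ * ∑ i ∈ Finset.range x, f i y := by
  cases x with
  | zero => simp at hx
  | succ k =>
    rw [uniformBelow, PMF.bind_map, PMF.bind_apply, tsum_fintype, Finset.mul_sum,
      ← Fin.sum_univ_eq_sum_range (fun i => ((k + 1 : ℕ) : ℝ≥0∞)⁻¹ * f i y)]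
    simp

theorem tsum_bind_mul {α β : Type*} (p : PMF α) (f : α → PMF β) (g : β → ℝ≥0∞) :
    ∑' y, (p.bind f) y * g y = ∑' a, p a * ∑' y, f a y * g y := by
  simp_rw [PMF.bind_apply, ← ENNReal.tsum_mul_right, ← ENNReal.tsum_mul_left]
  rw [ENNReal.tsum_comm]
  simp_rw [mul_assoc]

theorem tsum_pure_mul {α : Type*} (a : α) (g : α → ℝ≥0∞) :
    ∑' y, (PMF.pure a) y * g y = g a := by
  rw [tsum_eq_single a]
  · simp
  · intro b hb
    simp [PMF.pure_apply, hb]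

theorem bind_congr_support {α β : Type*} (p : PMF α) {f g : α → PMF β}
    (h : ∀ a ∈ p.support, f a = g a) : p.bind f = p.bind g := by
  ext y
  rw [PMF.bind_apply, PMF.bind_apply]
  refine tsum_congr fun a => ?_
  by_cases ha : p a = 0
  · simp [ha]
  · rw [h a ((PMF.mem_support_iff _ _).2 ha)]

/-! ### Runs -/

section Run

variable {n : ℕ} {G : SimpleGraph (Fin n)} [DecidableRel G.Adj]

/-- The distribution of the configuration `T` steps after the configuration `s`. -/
noncomputable def runFrom (I : Env G) : ℕ → Config → PMF Config
  | 0, s => PMF.pure s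
  | T + 1, s => (step G I.nbr I.M s).bind (runFrom I T)

/-- `runFor` adds steps at the end, while symbolic execution peels them off at the start;
associativity of `bind` reconciles the two. -/
theorem runFrom_bind_step (I : Env G) (T : ℕ) (s : Config) :
    (runFrom I T s).bind (step G I.nbr I.M) = runFrom I (T + 1) s := by
  induction T generalizing s with
  | zero => simp [runFrom]
  | succ T ih =>
    rw [runFrom, PMF.bind_bind]
    simp_rw [ih]
    rfl

theorem runFor_eq_runFrom (I : Env G) (A : Cmd) (T : ℕ) :
    runFor I A T = runFrom I T (Config.init A n I.k) := by
  induction T with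
  | zero => rfl
  | succ T ih => rw [runFor, ih, runFrom_bind_step]

theorem step_of_halted (I : Env G) {s : Config} (h : s.out.isSome) :
    step G I.nbr I.M s = PMF.pure s := by
  obtain ⟨K, R, q, st, o⟩ := s
  cases o with
  | none => simp at h
  | some o => rfl

theorem runFrom_of_halted (I : Env G) {s : Config} (h : s.out.isSome) (T : ℕ) :
    runFrom I T s = PMF.pure s := by
  induction T with
  | zero => rfl
  | succ T ih => rw [runFrom, step_of_halted I h, PMF.pure_bind, ih]

/-- A halted configuration that is possible after `T` steps is possible after each larger number
of steps. -/
theorem mem_support_runFor_of_le (I : Env G) (A : Cmd) {T T' : ℕ} (hT : T ≤ T') {s : Config}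
    (hs : s ∈ (runFor I A T).support) (ho : s.out.isSome) :
    s ∈ (runFor I A T').support := by
  induction hT with
  | refl => exact hs
  | step _ ih =>
    rw [runFor, PMF.mem_support_bind_iff]
    exact ⟨s, ih, by rw [step_of_halted I ho]; simp⟩

/-- Halted configurations are fixed by `step`, so mass on an outcome never leaves. The supremum in
`outcomeProb` is therefore attained once everything has halted; `queries_mono` plays the same role
for `expectedQueries`. -/
theorem outcome_mono (I : Env G) (A : Cmd) (o : Outcome) :
    Monotone fun T => ((runFor I A T).map Config.out) (some o) := by
  refine monotone_nat_of_le_succ fun T => ?_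
  simp only [runFor, ← PMF.bind_pure_comp, PMF.bind_bind]
  rw [PMF.bind_apply, PMF.bind_apply]
  refine ENNReal.tsum_le_tsum fun s => ?_
  gcongr
  by_cases h : s.out = some o
  · rw [step_of_halted I (by simp [h])]
    simp
  · simp [Function.comp, PMF.pure_apply, Ne.symm h]

theorem queries_le_of_mem_step (I : Env G) {s s' : Config}
    (h : s' ∈ (step G I.nbr I.M s).support) : s.queries ≤ s'.queries := by
  obtain ⟨K, R, q, st, o⟩ := s
  cases o with
  | some o =>
    rw [step_of_halted I (by simp)] at h
    simp only [PMF.support_pure, Set.mem_singleton_iff] at h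
    simp [h]
  | none =>
    cases K with
    | nil =>
      simp only [step, PMF.support_pure, Set.mem_singleton_iff] at h
      simp [h]
    | cons c K =>
      cases c <;>
        simp only [step, exec, PMF.support_pure, Set.mem_singleton_iff,
          PMF.mem_support_map_iff] at h <;>
        first
        | (subst h; simp [Config.store]; done)
        | (obtain ⟨a, -, rfl⟩ := h; simp [Config.store]; done)
        | (subst h; dsimp only; split <;> simp)

theorem queries_mono (I : Env G) (A : Cmd) :
    Monotone fun T => ∑' s, runFor I A T s * (s.queries : ℝ≥0∞) := by
  refine monotone_nat_of_le_succ fun T => ?_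
  simp only [runFor]
  rw [tsum_bind_mul]
  refine ENNReal.tsum_le_tsum fun s => ?_
  gcongr
  calc (s.queries : ℝ≥0∞)
      = ∑' y, step G I.nbr I.M s y * (s.queries : ℝ≥0∞) := by
        rw [ENNReal.tsum_mul_right, PMF.tsum_coe, one_mul]
    _ ≤ _ := by
        refine ENNReal.tsum_le_tsum fun y => ?_
        by_cases hy : step G I.nbr I.M s y = 0
        · simp [hy]
        · gcongr
          exact queries_le_of_mem_step I ((PMF.mem_support_iff _ _).2 hy)

/-! ### Symbolic execution -/

/-- The code `K`, started with the registers `R`, halts within a bounded number of steps, with an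
outcome distributed as `O`, after at most `q + Q` further queries in expectation. When it halts,
`c` steps are credited for each query, and the steps exceed this credit by less than `D`. -/
def Spec (I : Env G) (c : ℕ) (K : List Cmd) (R : ℕ → ℕ) (D q : ℕ) (O : PMF Outcome)
    (Q : ℝ≥0∞) : Prop :=
  ∀ q₀ st, ∃ (μ : PMF Config) (T₀ : ℕ),
    (∀ T, T₀ ≤ T → runFrom I T ⟨K, R, q₀, st, none⟩ = μ) ∧
    μ.map Config.out = O.map some ∧
    ∑' s, μ s * (s.queries : ℝ≥0∞) ≤ q₀ + q + Q ∧
    ∀ s ∈ μ.support, s.steps + c * q₀ + 1 ≤ st + c * s.queries + D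

/-! ### Proof rules for single instructions -/

namespace Spec

variable {I : Env G} {c : ℕ} {K : List Cmd} {R : ℕ → ℕ} {D q : ℕ} {O : PMF Outcome} {Q : ℝ≥0∞}

theorem mono {D' q' : ℕ} {Q' : ℝ≥0∞} (h : Spec I c K R D q O Q) (hD : D ≤ D') (hq : q ≤ q')
    (hQ : Q ≤ Q') : Spec I c K R D' q' O Q' := by
  intro q₀ st
  obtain ⟨μ, T₀, h1, h2, h3, h4⟩ := h q₀ st
  refine ⟨μ, T₀, h1, h2, h3.trans ?_, fun s hs => (h4 s hs).trans (by omega)⟩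
  gcongr

theorem of_queries (h : Spec I c K R D q O Q) : Spec I c K R D 0 O (q + Q) := by
  intro q₀ st
  obtain ⟨μ, T₀, h1, h2, h3, h4⟩ := h q₀ st
  exact ⟨μ, T₀, h1, h2, by simpa [add_assoc] using h3, h4⟩

/-- A deterministic step that makes `j` queries. -/
theorem of_step_eq {K' : List Cmd} {R' : ℕ → ℕ} {j : ℕ} {E : ℕ}
    (hstep : ∀ q₀ st, step G I.nbr I.M ⟨K, R, q₀, st, none⟩
      = PMF.pure ⟨K', R', q₀ + j, st + 1, none⟩)
    (h : Spec I c K' R' E q O Q) (hE : E + 1 ≤ D + c * j) :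
    Spec I c K R D (q + j) O Q := by
  intro q₀ st
  obtain ⟨μ, T₀, h1, h2, h3, h4⟩ := h (q₀ + j) (st + 1)
  refine ⟨μ, T₀ + 1, fun T hT => ?_, h2, h3.trans (le_of_eq ?_), fun s hs => ?_⟩
  · obtain ⟨T, rfl⟩ : ∃ T', T = T' + 1 := ⟨T - 1, by omega⟩
    rw [runFrom, hstep, PMF.pure_bind, h1 T (by omega)]
  · push_cast
    ring
  · have := h4 s hs
    rw [mul_add] at this
    omega

/-- A step that stores a random number and makes `j` queries. -/
theorem of_step_uniform {K' : List Cmd} {R' : ℕ → ℕ → ℕ} {j E X : ℕ} {O : ℕ → PMF Outcome}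
    {Q : ℕ → ℝ≥0∞}
    (hstep : ∀ q₀ st, step G I.nbr I.M ⟨K, R, q₀, st, none⟩
      = (uniformBelow X).map fun a => ⟨K', R' a, q₀ + j, st + 1, none⟩)
    (h : ∀ a < max X 1, Spec I c K' (R' a) E q (O a) (Q a)) (hE : E + 1 ≤ D + c * j) :
    Spec I c K R D (q + j) ((uniformBelow X).bind O) (∑' a, uniformBelow X a * Q a) := by
  intro q₀ st
  -- The bound on `a` is moved inside the existential so that `choose` yields total functions;
  -- outside the support the values are junk.
  have h' : ∀ a, ∃ (μ : PMF Config) (T₀ : ℕ), a < max X 1 →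
      (∀ T, T₀ ≤ T → runFrom I T ⟨K', R' a, q₀ + j, st + 1, none⟩ = μ) ∧
      μ.map Config.out = (O a).map some ∧
      ∑' s, μ s * (s.queries : ℝ≥0∞) ≤ (q₀ + j : ℕ) + q + Q a ∧
      ∀ s ∈ μ.support, s.steps + c * (q₀ + j) + 1 ≤ st + 1 + c * s.queries + E := by
    intro a
    by_cases ha : a < max X 1
    · obtain ⟨μ, T₀, h⟩ := h a ha (q₀ + j) (st + 1)
      exact ⟨μ, T₀, fun _ => h⟩
    · exact ⟨PMF.pure ⟨K, R, 0, 0, none⟩, 0, fun h => absurd h ha⟩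
  choose μ T₀ hμ using h'
  -- The support is finite, so the halting times of the branches have a common bound. The `max X 1`
  -- covers `X = 0`, where the draw is a point mass at `0`.
  refine ⟨(uniformBelow X).bind μ, (Finset.range (max X 1)).sup T₀ + 1, fun T hT => ?_, ?_, ?_,
    fun s hs => ?_⟩
  · obtain ⟨T, rfl⟩ : ∃ T', T = T' + 1 := ⟨T - 1, by omega⟩
    rw [runFrom, hstep, PMF.bind_map]
    refine bind_congr_support _ fun a ha => ?_
    have ha := mem_support_uniformBelow.1 ha
    refine (hμ a ha).1 T (le_trans ?_ (Nat.le_of_succ_le_succ hT))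
    exact Finset.le_sup (Finset.mem_range.2 ha)
  · rw [PMF.map_bind, PMF.map_bind]
    exact bind_congr_support _ fun a ha => (hμ a (mem_support_uniformBelow.1 ha)).2.1
  · rw [tsum_bind_mul]
    calc _ ≤ ∑' a, uniformBelow X a * (((q₀ + j : ℕ) + q) + Q a) := by
          refine ENNReal.tsum_le_tsum fun a => ?_
          by_cases ha : uniformBelow X a = 0
          · simp [ha]
          · gcongr
            exact (hμ a (mem_support_uniformBelow.1 ((PMF.mem_support_iff _ _).2 ha))).2.2.1
      _ = _ := by
          simp_rw [mul_add, ENNReal.tsum_add, ENNReal.tsum_mul_right, PMF.tsum_coe]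
          push_cast
          ring
  · obtain ⟨a, ha, hs⟩ := (PMF.mem_support_bind_iff _ _ _).1 hs
    have := (hμ a (mem_support_uniformBelow.1 ha)).2.2.2 s hs
    rw [mul_add] at this
    omega

theorem seq {a b : Cmd} (h : Spec I c (a :: b :: K) R D q O Q) :
    Spec I c (.seq a b :: K) R (D + 1) q O Q :=
  of_step_eq (j := 0) (fun _ _ => rfl) h le_rfl

theorem arith {r : ℕ} {op : Op} {x y : Operand} (a : ℕ)
    (ha : op.eval (x.val R) (y.val R) = a) (hM : a < I.M)
    (h : Spec I c K (Function.update R r a) D q O Q) :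
    Spec I c (.arith r op x y :: K) R (D + 1) q O Q :=
  of_step_eq (j := 0) (fun _ _ => by
    simp [step, exec, Config.store, ha, Nat.mod_eq_of_lt hM]) h le_rfl

theorem ifLT_pos {x y : Operand} {a b : Cmd} (hlt : x.val R < y.val R)
    (h : Spec I c (a :: K) R D q O Q) :
    Spec I c (.ifLT x y a b :: K) R (D + 1) q O Q :=
  of_step_eq (j := 0) (fun _ _ => by simp [step, exec, hlt]) h le_rfl

theorem ifLT_neg {x y : Operand} {a b : Cmd} (hlt : ¬ x.val R < y.val R)
    (h : Spec I c (b :: K) R D q O Q) :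
    Spec I c (.ifLT x y a b :: K) R (D + 1) q O Q :=
  of_step_eq (j := 0) (fun _ _ => by simp [step, exec, hlt]) h le_rfl

theorem whileLT_pos {x y : Operand} {a : Cmd} (hlt : x.val R < y.val R)
    (h : Spec I c (a :: .whileLT x y a :: K) R D q O Q) :
    Spec I c (.whileLT x y a :: K) R (D + 1) q O Q :=
  of_step_eq (j := 0) (fun _ _ => by simp [step, exec, hlt]) h le_rfl

theorem whileLT_neg {x y : Operand} {a : Cmd} (hlt : ¬ x.val R < y.val R)
    (h : Spec I c K R D q O Q) :
    Spec I c (.whileLT x y a :: K) R (D + 1) q O Q :=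
  of_step_eq (j := 0) (fun _ _ => by simp [step, exec, hlt]) h le_rfl

/-- A query costs one step and earns a credit of `c + 1`, so the slack `D` grows by `c`. -/
theorem degreeQuery {r : ℕ} {x : Operand} (a : ℕ) (ha : degreeAnswer G (x.val R) = a)
    (hM : a < I.M) (h : Spec I (c + 1) K (Function.update R r a) (D + c) q O Q) :
    Spec I (c + 1) (.degreeQuery r x :: K) R D (q + 1) O Q :=
  of_step_eq (j := 1) (fun _ _ => by
    simp [step, exec, Config.store, ha, Nat.mod_eq_of_lt hM]) h (by omega)

theorem neighborQuery {r : ℕ} {x y : Operand} (a : ℕ)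
    (ha : neighborAnswer G I.nbr (x.val R) (y.val R) = a)
    (hM : a < I.M) (h : Spec I (c + 1) K (Function.update R r a) (D + c) q O Q) :
    Spec I (c + 1) (.neighborQuery r x y :: K) R D (q + 1) O Q :=
  of_step_eq (j := 1) (fun _ _ => by
    simp [step, exec, Config.store, ha, Nat.mod_eq_of_lt hM]) h (by omega)

theorem rand {r X : ℕ} {x : Operand} {O : ℕ → PMF Outcome} {Q : ℕ → ℝ≥0∞} (hx : x.val R = X)
    (hX : max X 1 ≤ I.M) (h : ∀ a < max X 1, Spec I c K (Function.update R r a) D q (O a) (Q a)) :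
    Spec I c (.rand r x :: K) R (D + 1) q
      ((uniformBelow X).bind O) (∑' a, uniformBelow X a * Q a) :=
  of_step_uniform (j := 0) (X := X) (K' := K) (R' := fun a => Function.update R r (a % I.M))
    (fun _ _ => by simp [step, exec, Config.store, hx])
    (fun a ha => by rw [Nat.mod_eq_of_lt (ha.trans_le hX)]; exact h a ha) le_rfl

theorem vertexQuery {r : ℕ} {O : ℕ → PMF Outcome} {Q : ℕ → ℝ≥0∞} (hn : max n 1 ≤ I.M)
    (h : ∀ a < max n 1, Spec I (c + 1) K (Function.update R r a) (D + c) q (O a) (Q a)) :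
    Spec I (c + 1) (.vertexQuery r :: K) R D (q + 1)
      ((uniformBelow n).bind O) (∑' a, uniformBelow n a * Q a) :=
  of_step_uniform (j := 1) (X := n) (K' := K) (R' := fun a => Function.update R r (a % I.M))
    (fun _ _ => by simp [step, exec, Config.store])
    (fun a ha => by rw [Nat.mod_eq_of_lt (ha.trans_le hn)]; exact h a ha) (by omega)

/-- A vertex query whose answer does not matter. -/
theorem vertexQuery_const {r : ℕ} (hn : max n 1 ≤ I.M)
    (h : ∀ a < max n 1, Spec I (c + 1) K (Function.update R r a) (D + c) q O Q) :
    Spec I (c + 1) (.vertexQuery r :: K) R D (q + 1) O Q := by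
  have := vertexQuery (O := fun _ => O) (Q := fun _ => Q) hn h
  rwa [PMF.bind_const, ENNReal.tsum_mul_right, PMF.tsum_coe, one_mul] at this

theorem of_halts {x : Cmd} {o : Outcome}
    (hstep : ∀ q₀ st, step G I.nbr I.M ⟨x :: K, R, q₀, st, none⟩
      = PMF.pure ⟨K, R, q₀, st + 1, some o⟩) :
    Spec I c (x :: K) R (D + 2) q (PMF.pure o) Q := by
  intro q₀ st
  refine ⟨PMF.pure ⟨K, R, q₀, st + 1, some o⟩, 1, fun T hT => ?_, ?_, ?_, fun s hs => ?_⟩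
  · obtain ⟨T, rfl⟩ : ∃ T', T = T' + 1 := ⟨T - 1, by omega⟩
    rw [runFrom, hstep, PMF.pure_bind, runFrom_of_halted I (by simp)]
  · rw [PMF.pure_map, PMF.pure_map]
  · rw [tsum_pure_mul, add_assoc]
    exact le_self_add
  · rw [PMF.support_pure, Set.mem_singleton_iff] at hs
    subst hs
    dsimp only
    omega

theorem ret {x y : Operand} :
    Spec I c (.ret x y :: K) R (D + 2) q (PMF.pure (.pair (x.val R) (y.val R))) Q :=
  of_halts fun _ _ => rfl

theorem fail : Spec I c (.fail :: K) R (D + 2) q (PMF.pure .fail) Q :=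
  of_halts fun _ _ => rfl

end Spec

/-! ### Runs of a program that is specified -/

section Initial

variable {I : Env G} {A : Cmd} {c q : ℕ} {O : PMF Outcome} {Q : ℝ≥0∞}

theorem outcomeProb_eq (h : Spec I c [A] (Config.init A n I.k).regs 1 q O Q) (o : Outcome) :
    outcomeProb I A o = O o := by
  obtain ⟨μ, T₀, h1, h2, -, -⟩ := h 0 0
  have key : ∀ T, T₀ ≤ T → ((runFor I A T).map Config.out) (some o) = O o := by
    intro T hT
    rw [runFor_eq_runFrom, show Config.init A n I.k
      = ⟨[A], (Config.init A n I.k).regs, 0, 0, none⟩ from rfl, h1 T hT, h2]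
    rw [PMF.map_apply, tsum_eq_single o]
    · simp
    · intro b hb
      simp [Ne.symm hb]
  refine le_antisymm (iSup_le fun T => ?_) ?_
  · exact (outcome_mono I A o (le_max_left T T₀)).trans_eq (key _ (le_max_right _ _))
  · rw [← key T₀ le_rfl]
    exact le_iSup (fun T => ((runFor I A T).map Config.out) (some o)) T₀

theorem expectedQueries_le (h : Spec I c [A] (Config.init A n I.k).regs 1 q O Q) :
    expectedQueries I A ≤ q + Q := by
  obtain ⟨μ, T₀, h1, -, h3, -⟩ := h 0 0
  refine iSup_le fun T => (queries_mono I A (le_max_left T T₀)).trans ?_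
  dsimp only
  rw [runFor_eq_runFrom, show Config.init A n I.k
      = ⟨[A], (Config.init A n I.k).regs, 0, 0, none⟩ from rfl, h1 _ (le_max_right _ _)]
  simpa using h3

theorem steps_le (h : Spec I c [A] (Config.init A n I.k).regs 1 q O Q) {T : ℕ} {s : Config}
    (hs : s ∈ (runFor I A T).support) (ho : s.out.isSome) : s.steps ≤ c * s.queries := by
  obtain ⟨μ, T₀, h1, -, -, h4⟩ := h 0 0
  have hs' := mem_support_runFor_of_le I A (le_max_left T T₀) hs ho
  rw [runFor_eq_runFrom, show Config.init A n I.k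
      = ⟨[A], (Config.init A n I.k).regs, 0, 0, none⟩ from rfl, h1 _ (le_max_right _ _)] at hs'
  simpa using h4 s hs'

end Initial

end Run

/-! ### The program -/

namespace Program

/-- The command that does nothing of interest. -/
def skip : Cmd := .arith 4 .add (.const 0) (.const 0)

/-- One attempt to sample an edge with the degree threshold in register `8`. -/
def trial : Cmd :=
  .seq (.vertexQuery 9) <| .seq (.degreeQuery 10 (.reg 9)) <|
  .ifLT (.reg 8) (.reg 10) skip <| .seq (.rand 11 (.reg 8)) <|
  .ifLT (.reg 11) (.reg 10)
    (.seq (.neighborQuery 12 (.reg 9) (.reg 11)) <| .seq (.rand 13 (.const 2)) <|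
      .ifLT (.reg 13) (.const 1) (.ret (.reg 9) (.reg 12)) <|
      .seq (.degreeQuery 10 (.reg 12)) <|
      .ifLT (.reg 8) (.reg 10)
        (.seq (.rand 11 (.reg 10)) <| .seq (.neighborQuery 13 (.reg 12) (.reg 11)) <|
          .ret (.reg 12) (.reg 13))
        skip)
    skip

/-- The attempts number `1, …, R 5`, where attempt `t` has the threshold `R 6 / t`. -/
def trials : Cmd :=
  .whileLT (.reg 7) (.reg 5) <|
    .seq (.arith 7 .add (.reg 7) (.const 1)) <| .seq (.arith 8 .div (.reg 6) (.reg 7)) trial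

/-- Compute `256 * Nat.clog 2 n` in register `2`, at the price of one query for each round. -/
def logLoop : Cmd :=
  .whileLT (.reg 3) (.reg 0) <|
    .seq (.arith 3 .mul (.reg 3) (.const 2)) <|
    .seq (.arith 2 .add (.reg 2) (.const 256)) (.vertexQuery 4)

/-- The sampling algorithm. -/
def sampler : Cmd :=
  .seq (.vertexQuery 4) <| .seq (.arith 3 .add (.const 1) (.const 0)) <| .seq logLoop <|
  .seq (.arith 5 .mul (.reg 0) (.reg 0)) <|
  .seq (.ifLT (.reg 5) (.reg 1) (.arith 1 .add (.reg 5) (.const 0)) skip) <|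
  .seq (.arith 5 .mul (.reg 5) (.reg 2)) <|
  .seq (.arith 6 .mul (.reg 0) (.reg 2)) <| .seq (.arith 6 .mul (.reg 6) (.reg 1)) <|
  .seq trials .fail

end Program

/-! ### The distribution of its outcome -/

section Law

variable {n : ℕ} (G : SimpleGraph (Fin n)) [DecidableRel G.Adj] (nbr : NeighborOrder G)

/-- The law of the result of one attempt with degree threshold `θ`. -/
noncomputable def trialLaw (θ : ℕ) : PMF (Option Outcome) :=
  (uniformBelow n).bind fun u =>
    if θ < degreeAnswer G u then PMF.pure none else
      (uniformBelow θ).bind fun i =>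
        if i < degreeAnswer G u then
          (uniformBelow 2).bind fun r =>
            if r < 1 then PMF.pure (some (.pair u (neighborAnswer G nbr u i))) else
              if θ < degreeAnswer G (neighborAnswer G nbr u i) then
                (uniformBelow (degreeAnswer G (neighborAnswer G nbr u i))).bind fun j =>
                  PMF.pure (some (.pair (neighborAnswer G nbr u i)
                    (neighborAnswer G nbr (neighborAnswer G nbr u i) j)))
              else PMF.pure none
        else PMF.pure none

/-- Return the result of an attempt if there is one, and draw from `O` otherwise. -/
noncomputable def resume (O : PMF Outcome) : Option Outcome → PMF Outcome
  | none => O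
  | some o => PMF.pure o

/-- The law of the first result of the attempts `t, …, t + N - 1`. -/
noncomputable def trialsLaw (τ : ℕ → PMF (Option Outcome)) : ℕ → ℕ → PMF Outcome
  | _, 0 => PMF.pure .fail
  | t, N + 1 => (τ t).bind (resume (trialsLaw τ (t + 1) N))

/-- The expected number of the attempts `t, …, t + N - 1` up to the first result. -/
noncomputable def trialsCost (τ : ℕ → PMF (Option Outcome)) : ℕ → ℕ → ℝ≥0∞
  | _, 0 => 0
  | t, N + 1 => 1 + τ t none * trialsCost τ (t + 1) N

variable {G nbr}

theorem degreeAnswer_lt (hn : 0 < n) (v : ℕ) : degreeAnswer G v < n := by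
  unfold degreeAnswer
  split_ifs
  · simpa using G.degree_lt_card_verts ⟨v, by assumption⟩
  · exact hn

theorem neighborAnswer_le (v i : ℕ) : neighborAnswer G nbr v i ≤ n := by
  unfold neighborAnswer
  split_ifs
  · exact Fin.is_le'
  · rfl
  · rfl

end Law

/-! ### The program computes this distribution -/

section Correctness

variable {n : ℕ} {G : SimpleGraph (Fin n)} [DecidableRel G.Adj] {I : Env G} {c : ℕ}
  {K : List Cmd} {R : ℕ → ℕ} {D q : ℕ} {O : PMF Outcome} {Q : ℝ≥0∞}

namespace Spec

/-- The code `K` makes one attempt with law `τ`, and is continued by an attempt with outcome `O`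
and cost `Q` if that fails. -/
abbrev Attempt (I : Env G) (c : ℕ) (O : PMF Outcome) (Q : ℝ≥0∞) (K : List Cmd) (R : ℕ → ℕ)
    (D q : ℕ) (τ : PMF (Option Outcome)) : Prop :=
  Spec I c K R D q (τ.bind (resume O)) (τ none * Q)

theorem Attempt.none (h : Spec I c K R D q O Q) :
    Attempt I c O Q K R D q (PMF.pure none) := by
  simpa [Attempt, resume] using h

theorem Attempt.ret {x y : Operand} {a b : ℕ} (ha : x.val R = a) (hb : y.val R = b) :
    Attempt I c O Q (.ret x y :: K) R (D + 2) q (PMF.pure (some (.pair a b))) := by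
  subst ha hb
  simpa [Attempt, resume] using Spec.ret

/-- The cost `τ none * Q` is linear in `τ`, so averaging over the draw commutes with it. -/
theorem Attempt.rand {r X : ℕ} {x : Operand} {τ : ℕ → PMF (Option Outcome)} (hx : x.val R = X)
    (hX : max X 1 ≤ I.M)
    (h : ∀ a < max X 1, Attempt I c O Q K (Function.update R r a) D q (τ a)) :
    Attempt I c O Q (.rand r x :: K) R (D + 1) q ((uniformBelow X).bind τ) := by
  have := Spec.rand (r := r) hx hX h
  simp_rw [← mul_assoc, ENNReal.tsum_mul_right] at this
  rwa [Attempt, PMF.bind_bind, PMF.bind_apply]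

theorem Attempt.vertexQuery {r : ℕ} {τ : ℕ → PMF (Option Outcome)} (hn : max n 1 ≤ I.M)
    (h : ∀ a < max n 1, Attempt I (c + 1) O Q K (Function.update R r a) (D + c) q (τ a)) :
    Attempt I (c + 1) O Q (.vertexQuery r :: K) R D (q + 1) ((uniformBelow n).bind τ) := by
  have := Spec.vertexQuery (r := r) hn h
  simp_rw [← mul_assoc, ENNReal.tsum_mul_right] at this
  rwa [Attempt, PMF.bind_bind, PMF.bind_apply]

end Spec

open Program

theorem spec_skip (hM : 0 < I.M) (h : ∀ a, Spec I c K (Function.update R 4 a) D q O Q) :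
    Spec I c (skip :: K) R (D + 1) q O Q :=
  .arith 0 (by simp [Operand.val, Op.eval]) hM (h 0)

/-- An attempt writes only to register `4` and to registers from `8` on, so the loop data survive
it. Five is the number of queries on the longest branch, and the first query alone earns enough
credit to hand on a slack of `80`. -/
theorem spec_trial {θ : ℕ} (hn : 0 < n) (hnM : n < I.M) (hθ : R 8 = θ) (hθM : θ < I.M)
    (h : ∀ R', (∀ i < 8, i ≠ 4 → R' i = R i) → Spec I 101 K R' 80 0 O Q) :
    Spec.Attempt I 101 O Q (trial :: K) R 70 5 (trialLaw G I.nbr θ) := by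
  have h1 : max n 1 ≤ I.M := by omega
  have h0 : 0 < I.M := by omega
  have hdeg : ∀ v, degreeAnswer G v < I.M := fun v => (degreeAnswer_lt hn v).trans hnM
  have hnbr : ∀ v i, neighborAnswer G I.nbr v i < I.M :=
    fun v i => (neighborAnswer_le v i).trans_lt hnM
  have hskip : ∀ {R' : ℕ → ℕ} {D q : ℕ}, 81 ≤ D → (∀ i < 8, i ≠ 4 → R' i = R i) →
      Spec.Attempt I 101 O Q (skip :: K) R' D q (PMF.pure none) := by
    intro R' D q hD hR'
    refine Spec.Attempt.none (.mono (spec_skip (D := 80) (q := 0) h0 fun a => h _ ?_) hD q.zero_le le_rfl)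
    intro i hi hi'
    rw [Function.update_of_ne hi', hR' i hi hi']
  unfold trial trialLaw
  refine .seq (Spec.Attempt.vertexQuery h1 fun u _ => .seq (.degreeQuery _ rfl (hdeg _) ?_))
  by_cases hd : θ < degreeAnswer G u
  · rw [if_pos hd]
    refine .ifLT_pos (by simpa [Operand.val, hθ] using hd) (hskip (by norm_num) ?_)
    intro i hi hi'
    simp [Function.update_of_ne, show i ≠ 9 by omega, show i ≠ 10 by omega]
  rw [if_neg hd]
  refine .ifLT_neg (by simpa [Operand.val, hθ] using hd) (.seq (Spec.Attempt.rand (X := θ)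
    (by simpa [Operand.val] using hθ) (by omega) fun i _ => ?_))
  by_cases hi : i < degreeAnswer G u
  swap
  · rw [if_neg hi]
    refine .ifLT_neg (by simpa [Operand.val] using hi) (hskip (by norm_num) ?_)
    intro i hi hi'
    simp [Function.update_of_ne, show i ≠ 9 by omega, show i ≠ 10 by omega,
      show i ≠ 11 by omega]
  rw [if_pos hi]
  refine .ifLT_pos (by simpa [Operand.val] using hi) (.seq (.neighborQuery
    (neighborAnswer G I.nbr u i) (by simp [Operand.val]) (hnbr _ _) (.seq (Spec.Attempt.rand (X := 2)
    (by simp [Operand.val]) (by omega) fun r _ => ?_))))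
  by_cases hr : r < 1
  · rw [if_pos hr]
    exact .ifLT_pos (by simpa [Operand.val] using hr)
      (Spec.Attempt.ret (by simp [Operand.val]) (by simp [Operand.val]))
  rw [if_neg hr]
  refine .ifLT_neg (by simpa [Operand.val] using hr) (.seq (.degreeQuery
    (degreeAnswer G (neighborAnswer G I.nbr u i)) (by simp [Operand.val]) (hdeg _) ?_))
  by_cases hd' : θ < degreeAnswer G (neighborAnswer G I.nbr u i)
  swap
  · rw [if_neg hd']
    refine .ifLT_neg (by simpa [Operand.val, hθ] using hd') (hskip (by norm_num) ?_)
    intro i hi hi'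
    simp [Function.update_of_ne, show i ≠ 9 by omega, show i ≠ 10 by omega,
      show i ≠ 11 by omega, show i ≠ 12 by omega, show i ≠ 13 by omega]
  rw [if_pos hd']
  refine .ifLT_pos (by simpa [Operand.val, hθ] using hd') (.seq (Spec.Attempt.rand
    (X := degreeAnswer G (neighborAnswer G I.nbr u i)) (by simp [Operand.val])
    (by have := hdeg (neighborAnswer G I.nbr u i); omega) fun j _ => ?_))
  exact .seq (.neighborQuery (neighborAnswer G I.nbr (neighborAnswer G I.nbr u i) j)
    (by simp [Operand.val]) (hnbr _ _)
    (Spec.Attempt.ret (by simp [Operand.val]) (by simp [Operand.val])))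

/-- The slack `80` is the loop invariant of the step count: each round starts with it and, by
`spec_trial`, restores it. -/
theorem spec_trials (hn : 0 < n) (hnM : n < I.M) {B t N : ℕ} (h6 : R 6 = B) (hB : B < I.M)
    (h7 : R 7 = t) (h5 : R 5 = t + N) (hN : t + N < I.M) :
    Spec I 101 [trials, .fail] R 80 0
      (trialsLaw (fun s => trialLaw G I.nbr (B / (s + 1))) t N)
      (5 * trialsCost (fun s => trialLaw G I.nbr (B / (s + 1))) t N) := by
  induction N generalizing R t with
  | zero =>
    exact .whileLT_neg (by simp [Operand.val, h5, h7]) .fail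
  | succ N ih =>
    have key := fun R' h1 h2 h3 h4 => ih (R := R') (t := t + 1) h1 h2 h3 h4
    have : 5 * trialsCost (fun s => trialLaw G I.nbr (B / (s + 1))) t (N + 1)
        = (5 : ℕ) + trialLaw G I.nbr (B / (t + 1)) none *
          (5 * trialsCost (fun s => trialLaw G I.nbr (B / (s + 1))) (t + 1) N) := by
      rw [trialsCost]
      push_cast
      ring
    rw [this]
    refine .of_queries (.whileLT_pos (by simp [Operand.val, h5, h7])
      (.seq (.arith (t + 1) (by simp [Operand.val, Op.eval, h7]) (by omega)
      (.seq (.arith (B / (t + 1)) (by simp [Operand.val, Op.eval, h6])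
        ((Nat.div_le_self _ _).trans_lt hB) (.mono (spec_trial hn hnM (by simp)
          ((Nat.div_le_self _ _).trans_lt hB) fun R' hR' => key R' ?_ ?_ ?_ ?_)
          (by norm_num) le_rfl le_rfl))))))
    · simp [hR', h6]
    · simp [hR']
    · simp [hR', h5]; omega
    · omega

/-- Register `3` runs through the powers of two below `n`. The vertex query in each round is a dummy
that pays for the arithmetic, keeping the running time linear in the number of queries. -/
theorem spec_logLoop (hn : 0 < n) (hM : 256 * n ≤ I.M) {i j : ℕ} (h0 : R 0 = n)
    (h3 : R 3 = 2 ^ i) (h2 : R 2 = 256 * i) (hij : i + j = Nat.clog 2 n)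
    (h : ∀ R', R' 0 = n → R' 1 = R 1 → R' 7 = R 7 → R' 2 = 256 * Nat.clog 2 n →
      Spec I 101 K R' 95 q O Q) :
    Spec I 101 (logLoop :: K) R 96 (q + j) O Q := by
  induction j generalizing R i with
  | zero =>
    refine .whileLT_neg ?_ (h R h0 rfl rfl (by rw [h2, ← hij, add_zero]))
    simpa [Operand.val, h0, h3, ← hij] using Nat.le_pow_clog one_lt_two n
  | succ j ih =>
    have hlt : 2 ^ i < n := (Nat.lt_clog_iff_pow_lt one_lt_two).1 (by omega)
    have hi : i < 2 ^ i := Nat.lt_two_pow_self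
    refine .mono (D := 96) (.whileLT_pos (by simpa [Operand.val, h0, h3] using hlt)
      (.seq (.arith (2 ^ (i + 1)) (by simp [Operand.val, Op.eval, h3, pow_succ])
        (by rw [pow_succ]; omega)
      (.seq (.arith (256 * (i + 1)) (by simp [Operand.val, Op.eval, h2]; ring) (by omega)
      (.vertexQuery_const (by omega) fun a _ =>
        .mono (ih (i := i + 1) ?_ ?_ ?_ (by omega) ?_) (by norm_num) le_rfl le_rfl)))))) le_rfl
        le_rfl le_rfl
    · simp [h0]
    · simp
    · simp
    · simpa using h

theorem spec_sampler {b : ℕ} (hb : 12 ≤ b) (hn : 2 ≤ n) (hk : 2 ≤ I.k)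
    (hM : I.M = (n + I.k) ^ b) :
    Spec I 101 [sampler] (Config.init sampler n I.k).regs 1 (1 + Nat.clog 2 n)
      (trialsLaw (fun s => trialLaw G I.nbr
        (n * (256 * Nat.clog 2 n) * min I.k (n * n) / (s + 1))) 0
        (n * n * (256 * Nat.clog 2 n)))
      (5 * trialsCost (fun s => trialLaw G I.nbr
        (n * (256 * Nat.clog 2 n) * min I.k (n * n) / (s + 1))) 0
        (n * n * (256 * Nat.clog 2 n))) := by
  have hclog : Nat.clog 2 n ≤ n := Nat.clog_le_of_le_pow Nat.lt_two_pow_self.le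
  -- All computed values are at most `256 * n ^ 4`, so no reduction modulo `I.M` ever takes effect.
  -- Since `4 ≤ n + k`, the exponent `8` covers them and any `b ≥ 12` leaves room.
  have hM1 : 256 * n ^ 4 < I.M := by
    rw [hM]
    calc 256 * n ^ 4 = 4 ^ 4 * n ^ 4 := by norm_num
      _ ≤ (n + I.k) ^ 4 * (n + I.k) ^ 4 := by gcongr <;> omega
      _ = (n + I.k) ^ 8 := by ring
      _ < (n + I.k) ^ b := Nat.pow_lt_pow_right (by omega) (by omega)
  set L := 256 * Nat.clog 2 n with hL
  have hLn : L ≤ 256 * n := by omega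
  have hk' : min I.k (n * n) ≤ n * n := min_le_right _ _
  have e1 : n * L ≤ 256 * n ^ 2 := by nlinarith
  have e2 : n * L * min I.k (n * n) ≤ 256 * n ^ 4 := by
    calc _ ≤ 256 * n ^ 2 * (n * n) := Nat.mul_le_mul e1 hk'
      _ = _ := by ring
  have e3 : n * n * L ≤ 256 * n ^ 3 := by
    calc _ = n * (n * L) := by ring
      _ ≤ n * (256 * n ^ 2) := Nat.mul_le_mul le_rfl e1
      _ = _ := by ring
  have p1 : n ≤ n ^ 4 := Nat.le_self_pow (by norm_num) n
  have p2 : n ^ 2 ≤ n ^ 4 := Nat.pow_le_pow_right (by omega) (by norm_num)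
  have p3 : n ^ 3 ≤ n ^ 4 := Nat.pow_le_pow_right (by omega) (by norm_num)
  have p0 : n * n = n ^ 2 := by ring
  refine .mono (q := 0 + Nat.clog 2 n + 1) (.seq (.vertexQuery_const (by omega) fun a _ => .seq
    (.arith 1 (by simp [Operand.val, Op.eval]) (by omega) (.seq (.mono
    (spec_logLoop (i := 0) (by omega) (by omega) (by simp [Config.init])
      (by simp) (by simp [Config.init]) (by simp) ?_) (by norm_num) le_rfl le_rfl)))))
    le_rfl (by omega) le_rfl
  intro R h0 h1 h7 h2
  rw [← hL] at h2
  replace h1 : R 1 = I.k := by simpa [Config.init] using h1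
  replace h7 : R 7 = 0 := by simpa [Config.init] using h7
  refine .seq (.arith (n * n) (by simp [Operand.val, Op.eval, h0]) (by omega) (.seq ?_))
  -- The code after the capping of `k`, shared by both branches of the conditional.
  have rest : ∀ R', R' 0 = n → R' 1 = min I.k (n * n) → R' 2 = L → R' 5 = n * n → R' 7 = 0 →
      ∀ K, K = ([.seq (.arith 5 .mul (.reg 5) (.reg 2)) <|
        .seq (.arith 6 .mul (.reg 0) (.reg 2)) <| .seq (.arith 6 .mul (.reg 6) (.reg 1)) <|
        .seq trials .fail] : List Cmd) →
      Spec I 101 K R' 90 0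
      (trialsLaw (fun s => trialLaw G I.nbr (n * L * min I.k (n * n) / (s + 1))) 0 (n * n * L))
      (5 * trialsCost (fun s => trialLaw G I.nbr (n * L * min I.k (n * n) / (s + 1))) 0
        (n * n * L)) := by
    rintro R' h0 h1 h2 h5 h7 _ rfl
    refine .mono (D := 87) (.seq (.arith (n * n * L) (by simp [Operand.val, Op.eval, h5, h2])
      (by omega)
      (.seq (.arith (n * L) (by simp [Operand.val, Op.eval, h0, h2]) (by omega)
      (.seq (.arith (n * L * min I.k (n * n)) (by simp [Operand.val, Op.eval, h1]) (by omega)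
      (.seq (spec_trials (by omega) (by omega) (by simp) (by omega) (by simp [h7])
        (by simp) (by omega))))))))) (by norm_num) le_rfl le_rfl
  by_cases hlt : n * n < I.k
  · refine .ifLT_pos (by simpa [Operand.val, h1] using hlt) (.arith (n * n)
      (by simp [Operand.val, Op.eval]) (by omega) (.mono (rest _ ?_ ?_ ?_ ?_ ?_ _ rfl)
        (by norm_num) le_rfl le_rfl))
    · simp [h0]
    · simp [min_eq_right hlt.le]
    · simp [h2]
    · simp
    · simp [h7]
  · refine .ifLT_neg (by simpa [Operand.val, h1] using hlt) (spec_skip (by omega) fun a =>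
      .mono (rest _ ?_ ?_ ?_ ?_ ?_ _ rfl) (by norm_num) le_rfl le_rfl)
    · simp [h0]
    · simp [h1, min_eq_left (not_lt.1 hlt)]
    · simp [h2]
    · simp
    · simp [h7]

end Correctness

/-! ### The probability that an attempt returns a given edge -/

section TrialProbability

theorem injective_pair {n : ℕ} {G : SimpleGraph (Fin n)} :
    Function.Injective fun e : G.Dart => Outcome.pair e.fst e.snd := by
  intro e e' h
  simp only [Outcome.pair.injEq, Fin.val_inj] at h
  exact SimpleGraph.Dart.ext _ _ (Prod.ext h.1 h.2)

variable {n : ℕ} {G : SimpleGraph (Fin n)} [DecidableRel G.Adj] {nbr : NeighborOrder G}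

theorem degreeAnswer_val (u : Fin n) : degreeAnswer G u = G.degree u := by
  simp [degreeAnswer]

theorem neighborAnswer_val (u : Fin n) {i : ℕ} (hi : i < G.degree u) :
    neighborAnswer G nbr u i = (nbr u ⟨i, hi⟩ : Fin n) := by
  simp [neighborAnswer, hi]

theorem sum_neighborAnswer {M : Type*} [AddCommMonoid M] (u : Fin n) (F : ℕ → M) :
    ∑ i ∈ Finset.range (G.degree u), F (neighborAnswer G nbr u i)
      = ∑ v ∈ G.neighborFinset u, F v := by
  rw [← Fin.sum_univ_eq_sum_range (fun i => F (neighborAnswer G nbr u i)),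
    SimpleGraph.neighborFinset, ← Finset.sum_set_coe (G.neighborSet u) (f := fun v : Fin n => F v),
    ← Equiv.sum_comp (nbr u)]
  exact Finset.sum_congr rfl fun i _ => by rw [neighborAnswer_val u i.2]

/-- Only edges are returned by an attempt. -/
theorem exists_dart_of_mem_trialLaw {θ : ℕ} (hn : 0 < n) {o : Outcome}
    (h : some o ∈ (trialLaw G nbr θ).support) :
    ∃ e : G.Dart, o = .pair e.fst e.snd := by
  have edge : ∀ u < n, ∀ i < degreeAnswer G u, ∃ e : G.Dart,
      (e.fst : ℕ) = u ∧ (e.snd : ℕ) = neighborAnswer G nbr u i := by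
    intro u hu i hi
    lift u to Fin n using hu
    rw [degreeAnswer_val] at hi
    exact ⟨⟨(u, nbr u ⟨i, hi⟩), (nbr u ⟨i, hi⟩).2⟩, rfl, (neighborAnswer_val u hi).symm⟩
  obtain ⟨u, hu, h⟩ := (PMF.mem_support_bind_iff _ _ _).1 h
  replace hu : u < n := by simpa [show max n 1 = n by omega] using mem_support_uniformBelow.1 hu
  by_cases h1 : θ < degreeAnswer G u
  · simp [h1] at h
  rw [if_neg h1] at h
  obtain ⟨i, -, h⟩ := (PMF.mem_support_bind_iff _ _ _).1 h
  by_cases h2 : i < degreeAnswer G u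
  swap
  · simp [h2] at h
  rw [if_pos h2] at h
  obtain ⟨e, he1, he2⟩ := edge u hu i h2
  obtain ⟨r, -, h⟩ := (PMF.mem_support_bind_iff _ _ _).1 h
  by_cases h3 : r < 1
  · simp only [h3, if_true, PMF.support_pure, Set.mem_singleton_iff, Option.some.injEq] at h
    exact ⟨e, by rw [h, he1, he2]⟩
  rw [if_neg h3] at h
  by_cases h4 : θ < degreeAnswer G (neighborAnswer G nbr u i)
  · rw [if_pos h4] at h
    obtain ⟨j, hj, h⟩ := (PMF.mem_support_bind_iff _ _ _).1 h
    have hv : neighborAnswer G nbr u i < n := he2 ▸ e.snd.2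
    obtain ⟨e', he1', he2'⟩ := edge _ hv j (by
      have := mem_support_uniformBelow.1 hj
      omega)
    simp only [PMF.support_pure, Set.mem_singleton_iff, Option.some.injEq] at h
    exact ⟨e', by rw [h, he1', he2']⟩
  · rw [if_neg h4] at h
    simp at h

open scoped Classical in
-- The factor `2⁻¹` is the coin; the two summands are its outcomes, returning the edge just found or
-- moving on from a heavy endpoint.
theorem trialLaw_apply_some {θ : ℕ} (hn : 0 < n) (hθ : 0 < θ) (o : Outcome) :
    trialLaw G nbr θ (some o) = (n : ℝ≥0∞)⁻¹ * ∑ u : Fin n, if θ < G.degree u then 0 else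
      (θ : ℝ≥0∞)⁻¹ * ∑ v ∈ G.neighborFinset u, 2⁻¹ * ((if o = .pair u v then 1 else 0) +
        if θ < G.degree v then (G.degree v : ℝ≥0∞)⁻¹ * ∑ w ∈ G.neighborFinset v,
          (if o = .pair v w then 1 else 0) else 0) := by
  rw [trialLaw, uniformBelow_bind_apply hn, ← Fin.sum_univ_eq_sum_range]
  congr 1
  refine Finset.sum_congr rfl fun u _ => ?_
  rw [degreeAnswer_val]
  split_ifs with h1
  · simp
  rw [uniformBelow_bind_apply hθ]
  simp_rw [apply_ite (fun p : PMF (Option Outcome) => p (some o)), PMF.pure_apply,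
    reduceCtorEq, if_false]
  rw [← Finset.sum_filter, show (Finset.range θ).filter (· < G.degree u)
    = Finset.range (G.degree u) by ext; simp; omega,
    sum_neighborAnswer (nbr := nbr) u fun v => ((uniformBelow 2).bind fun r =>
            if r < 1 then PMF.pure (some (.pair u v)) else
              if θ < degreeAnswer G v then
                (uniformBelow (degreeAnswer G v)).bind fun j =>
                  PMF.pure (some (.pair v (neighborAnswer G nbr v j)))
              else PMF.pure none) (some o)]
  congr 1
  refine Finset.sum_congr rfl fun v _ => ?_
  rw [uniformBelow_bind_apply (by norm_num), degreeAnswer_val]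
  simp only [Finset.sum_range_succ, Finset.sum_range_zero, zero_add, Nat.cast_ofNat]
  rw [if_pos one_pos, if_neg (lt_irrefl 1)]
  congr 2
  · simp [PMF.pure_apply]
  · split_ifs with h2
    · rw [uniformBelow_bind_apply (by omega), ← sum_neighborAnswer (nbr := nbr) v
        fun w => if o = .pair v w then 1 else 0]
      simp [PMF.pure_apply]
    · simp

/-- The probability that an attempt returns a light edge. -/
theorem trialLaw_apply_of_degree_le {θ : ℕ} (hn : 0 < n) (hθ : 0 < θ) (e : G.Dart)
    (he : G.degree e.fst ≤ θ) :
    trialLaw G nbr θ (some (.pair e.fst e.snd)) = (n : ℝ≥0∞)⁻¹ * ((θ : ℝ≥0∞)⁻¹ * 2⁻¹) := by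
  rw [trialLaw_apply_some hn hθ, Finset.sum_eq_single e.fst, if_neg he.not_gt]
  rotate_left
  -- The second stage emits only edges out of heavy vertices, so a light edge can arise only in the
  -- first stage, from its own tail.
  · intro u _ hu
    split_ifs with h
    · rfl
    rw [Finset.sum_eq_zero, mul_zero]
    intro v _
    rw [if_neg, zero_add, mul_eq_zero]
    · right
      split_ifs with h'
      · rw [Finset.sum_eq_zero, mul_zero]
        intro w _
        rw [if_neg]
        intro h0
        simp only [Outcome.pair.injEq, Fin.val_inj] at h0
        exact h'.not_ge (h0.1 ▸ he)
      · rfl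
    · intro h0
      simp only [Outcome.pair.injEq, Fin.val_inj] at h0
      exact hu h0.1.symm
  · simp
  congr 2
  rw [Finset.sum_eq_single e.snd]
  · rw [if_pos rfl, ite_eq_right_iff.2, add_zero, mul_one]
    intro _
    rw [Finset.sum_eq_zero, mul_zero]
    intro w _
    rw [if_neg]
    intro h0
    simp only [Outcome.pair.injEq, Fin.val_inj] at h0
    exact e.fst_ne_snd h0.1
  · intro v hv hne
    rw [if_neg, zero_add, mul_eq_zero]
    · right
      split_ifs with h'
      · rw [Finset.sum_eq_zero, mul_zero]
        intro w _
        rw [if_neg]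
        intro h0
        simp only [Outcome.pair.injEq, Fin.val_inj] at h0
        exact h'.not_ge (h0.1 ▸ he)
      · rfl
    · intro h0
      simp only [Outcome.pair.injEq, Fin.val_inj] at h0
      exact hne h0.2.symm
  · intro h
    exact absurd ((G.mem_neighborFinset _ _).2 e.adj) h

/-- The probability that an attempt returns a heavy edge. -/
theorem trialLaw_apply_of_lt_degree {θ : ℕ} (hn : 0 < n) (hθ : 0 < θ) (e : G.Dart)
    (he : θ < G.degree e.fst) :
    trialLaw G nbr θ (some (.pair e.fst e.snd)) = (n : ℝ≥0∞)⁻¹ * ((θ : ℝ≥0∞)⁻¹ * 2⁻¹) *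
      ((G.degree e.fst : ℝ≥0∞)⁻¹ *
        ((G.neighborFinset e.fst).filter fun u => G.degree u ≤ θ).card) := by
  classical
  -- The second stage emits `e` only from `e.fst`, as one of `d(e.fst)` equally likely edges.
  have h1 : ∀ v : Fin n, (if θ < G.degree v then (G.degree v : ℝ≥0∞)⁻¹ *
      ∑ w ∈ G.neighborFinset v,
        (if Outcome.pair e.fst e.snd = .pair v w then (1 : ℝ≥0∞) else 0) else 0)
      = if v = e.fst then (G.degree e.fst : ℝ≥0∞)⁻¹ else 0 := by
    intro v
    by_cases hv : v = e.fst
    · subst hv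
      rw [if_pos he, if_pos rfl, Finset.sum_eq_single e.snd]
      · simp
      · intro w _ hw
        rw [if_neg]
        intro h0
        simp only [Outcome.pair.injEq, Fin.val_inj] at h0
        exact hw h0.2.symm
      · intro h
        exact absurd ((G.mem_neighborFinset _ _).2 e.adj) h
    · rw [if_neg hv, ite_eq_right_iff]
      intro _
      rw [Finset.sum_eq_zero, mul_zero]
      intro w _
      rw [if_neg]
      intro h0
      simp only [Outcome.pair.injEq, Fin.val_inj] at h0
      exact hv h0.1.symm
  rw [trialLaw_apply_some hn hθ]
  simp_rw [h1]
  -- The first stage arrives at `e.fst` only from a light neighbour, and each of these contributes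
  -- the same amount.
  have h2 : ∀ u : Fin n, (if θ < G.degree u then 0 else
      (θ : ℝ≥0∞)⁻¹ * ∑ v ∈ G.neighborFinset u, 2⁻¹ *
        ((if Outcome.pair e.fst e.snd = .pair u v then (1 : ℝ≥0∞) else 0) +
          if v = e.fst then (G.degree e.fst : ℝ≥0∞)⁻¹ else 0))
      = if u ∈ (G.neighborFinset e.fst).filter (fun u => G.degree u ≤ θ) then
          (θ : ℝ≥0∞)⁻¹ * (2⁻¹ * (G.degree e.fst : ℝ≥0∞)⁻¹) else 0 := by
    intro u
    by_cases hu : θ < G.degree u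
    · rw [if_pos hu, if_neg]
      simp [hu]
    have hue : u ≠ e.fst := by
      rintro rfl
      exact hu he
    have h3 : ∀ v : Fin n, ¬ Outcome.pair e.fst e.snd = .pair u v := by
      intro v h0
      simp only [Outcome.pair.injEq, Fin.val_inj] at h0
      exact hue h0.1.symm
    simp_rw [if_neg (h3 _), zero_add, ← Finset.mul_sum, Finset.sum_ite_eq']
    rw [if_neg hu]
    simp only [SimpleGraph.mem_neighborFinset, Finset.mem_filter, not_lt.1 hu, and_true,
      G.adj_comm e.fst u]
    split_ifs <;> simp
  simp_rw [h2]
  rw [Finset.sum_ite_mem, Finset.univ_inter, Finset.sum_const, nsmul_eq_mul]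
  ring

/-- Each heavy neighbour contributes at least `θ + 1` to the degree sum. -/
theorem card_filter_lt_degree_mul_le (θ : ℕ) (v : Fin n) :
    ((G.neighborFinset v).filter fun u => θ < G.degree u).card * (θ + 1)
      ≤ Fintype.card G.Dart := by
  rw [G.dart_card_eq_sum_degrees, ← smul_eq_mul, ← Finset.sum_const]
  calc _ ≤ ∑ u ∈ (G.neighborFinset v).filter fun u => θ < G.degree u, G.degree u :=
        Finset.sum_le_sum fun u hu => (Finset.mem_filter.1 hu).2
    _ ≤ _ := Finset.sum_le_sum_of_subset (Finset.subset_univ _)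

/-- The probability that an attempt returns the edge `e`. -/
noncomputable def dartProb (nbr : NeighborOrder G) (θ : ℕ) (e : G.Dart) : ℝ :=
  (trialLaw G nbr θ (some (.pair e.fst e.snd))).toReal

theorem dartProb_le {θ : ℕ} (hn : 0 < n) (hθ : 0 < θ) (e : G.Dart) :
    dartProb nbr θ e ≤ 1 / (2 * n * θ) := by
  have hn' : (n : ℝ) ≠ 0 := by positivity
  have hθ' : (θ : ℝ) ≠ 0 := by positivity
  rw [dartProb]
  rcases le_or_gt (G.degree e.fst) θ with he | he
  · rw [trialLaw_apply_of_degree_le hn hθ e he]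
    simp
    apply le_of_eq
    field_simp
  · rw [trialLaw_apply_of_lt_degree hn hθ e he]
    have hd : (0 : ℝ) < G.degree e.fst := by exact_mod_cast (by omega : 0 < G.degree e.fst)
    have hc : (((G.neighborFinset e.fst).filter fun u => G.degree u ≤ θ).card : ℝ)
        ≤ G.degree e.fst := by
      exact_mod_cast Finset.card_filter_le _ _
    simp only [ENNReal.toReal_mul, ENNReal.toReal_inv, ENNReal.toReal_natCast,
      ENNReal.toReal_ofNat]
    calc _ ≤ (n : ℝ)⁻¹ * ((θ : ℝ)⁻¹ * 2⁻¹) * ((G.degree e.fst : ℝ)⁻¹ * G.degree e.fst) := by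
          gcongr
      _ = _ := by
          field_simp

theorem le_dartProb {θ : ℕ} {η : ℝ} (hn : 0 < n) (hθ : 0 < θ) (hη : 0 ≤ η)
    (h : (Fintype.card G.Dart : ℝ) ≤ η * (θ + 1) ^ 2 ∨ n ≤ θ) (e : G.Dart) :
    (1 - η) / (2 * n * θ) ≤ dartProb nbr θ e := by
  have hn' : (0 : ℝ) < n := by positivity
  have hθ' : (0 : ℝ) < θ := by positivity
  rw [dartProb]
  rcases le_or_gt (G.degree e.fst) θ with he | he
  · rw [trialLaw_apply_of_degree_le hn hθ e he]
    simp
    rw [div_le_iff₀ (by positivity)]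
    field_simp
    linarith
  · rw [trialLaw_apply_of_lt_degree hn hθ e he]
    -- A threshold of at least `n` would leave no heavy vertex.
    replace h := h.resolve_right (by
      have := G.degree_lt_card_verts e.fst
      simp at this
      omega)
    have hd : (0 : ℝ) < G.degree e.fst := by exact_mod_cast (by omega : 0 < G.degree e.fst)
    have hcount : (((G.neighborFinset e.fst).filter fun u => G.degree u ≤ θ).card : ℝ)
        + ((G.neighborFinset e.fst).filter fun u => θ < G.degree u).card = G.degree e.fst := by
      have := Finset.card_filter_add_card_filter_not (s := G.neighborFinset e.fst)
        (fun u => G.degree u ≤ θ)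
      simp only [not_le, G.card_neighborFinset_eq_degree] at this
      exact_mod_cast this
    set l := ((G.neighborFinset e.fst).filter fun u => G.degree u ≤ θ).card
    set H := ((G.neighborFinset e.fst).filter fun u => θ < G.degree u).card with hH
    have hH' : (H : ℝ) * (θ + 1) ≤ Fintype.card G.Dart := by
      exact_mod_cast card_filter_lt_degree_mul_le (G := G) θ e.fst
    have hHη : (H : ℝ) ≤ η * (θ + 1) := by
      have : (H : ℝ) * (θ + 1) ≤ (η * (θ + 1)) * (θ + 1) := by nlinarith
      exact le_of_mul_le_mul_right this (by positivity)
    have hdθ : (θ : ℝ) + 1 ≤ G.degree e.fst := by exact_mod_cast he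
    -- There are at most `η (θ + 1)` heavy neighbours, and `θ + 1 ≤ d(e.fst)` because `e.fst` is
    -- heavy.
    have hl : (1 - η) * G.degree e.fst ≤ l := by nlinarith
    simp only [ENNReal.toReal_mul, ENNReal.toReal_inv, ENNReal.toReal_natCast,
      ENNReal.toReal_ofNat]
    rw [div_le_iff₀ (by positivity)]
    field_simp
    linarith

/-- The probability that an attempt fails. -/
theorem trialLaw_apply_none {θ : ℕ} (hn : 0 < n) :
    (trialLaw G nbr θ none).toReal = 1 - ∑ e, dartProb nbr θ e := by
  have h := (trialLaw G nbr θ).tsum_coe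
  -- An attempt either fails or returns an edge, so its total mass is a finite sum over `Option
  -- G.Dart`.
  rw [← (Option.map_injective (injective_pair (G := G))).tsum_eq
    (f := fun o => trialLaw G nbr θ o), tsum_fintype, Fintype.sum_option] at h
  · have h' := congrArg ENNReal.toReal h
    rw [ENNReal.toReal_add (PMF.apply_ne_top _ _)
      (ENNReal.sum_ne_top.2 fun e _ => PMF.apply_ne_top _ _),
      ENNReal.toReal_sum fun e _ => PMF.apply_ne_top _ _, ENNReal.toReal_one] at h'
    simp only [Option.map_none, Option.map_some] at h'
    simp only [dartProb]
    linarith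
  · rintro (_ | o) ho
    · exact ⟨none, rfl⟩
    · obtain ⟨e, rfl⟩ := exists_dart_of_mem_trialLaw hn ((PMF.mem_support_iff _ _).2 ho)
      exact ⟨some e, rfl⟩

/-! ### Repeated attempts -/

/-- The probability that the attempts `t, …, t + i - 1` fail. -/
noncomputable def reach (τ : ℕ → PMF (Option Outcome)) (t i : ℕ) : ℝ :=
  ∏ s ∈ Finset.range i, (τ (t + s) none).toReal

theorem reach_succ' (τ : ℕ → PMF (Option Outcome)) (t i : ℕ) :
    reach τ t (i + 1) = (τ t none).toReal * reach τ (t + 1) i := by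
  rw [reach, Finset.prod_range_succ', mul_comm, reach]
  simp [add_assoc, add_comm 1]

theorem trialsLaw_apply (τ : ℕ → PMF (Option Outcome)) (t N : ℕ) {o : Outcome}
    (ho : o ≠ .fail) :
    (trialsLaw τ t N o).toReal
      = ∑ i ∈ Finset.range N, reach τ t i * (τ (t + i) (some o)).toReal := by
  induction N generalizing t with
  | zero => simp [trialsLaw, ho]
  | succ N ih =>
    have h : trialsLaw τ t (N + 1) o = τ t none * trialsLaw τ (t + 1) N o + τ t (some o) := by
      rw [trialsLaw, PMF.bind_apply, ENNReal.tsum_eq_add_tsum_ite none]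
      congr 1
      rw [tsum_eq_single (some o)]
      · simp [resume]
      · rintro (_ | o') ho'
        · simp
        · simp [resume, PMF.pure_apply, show o ≠ o' by rintro rfl; exact ho' rfl]
    rw [h, ENNReal.toReal_add (ENNReal.mul_ne_top (PMF.apply_ne_top _ _) (PMF.apply_ne_top _ _))
      (PMF.apply_ne_top _ _), ENNReal.toReal_mul, ih, Finset.sum_range_succ', Finset.mul_sum]
    congr 1
    · refine Finset.sum_congr rfl fun i _ => ?_
      rw [reach_succ', show t + 1 + i = t + (i + 1) by ring]
      ring
    · simp [reach]

theorem mem_support_trialsLaw {τ : ℕ → PMF (Option Outcome)} {t N : ℕ} {o : Outcome}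
    (ho : o ≠ .fail) (h : o ∈ (trialsLaw τ t N).support) :
    ∃ s, some o ∈ (τ s).support := by
  induction N generalizing t with
  | zero => simp [trialsLaw, ho] at h
  | succ N ih =>
    obtain ⟨(_ | o'), ho', h⟩ := (PMF.mem_support_bind_iff _ _ _).1 h
    · exact ih h
    · simp only [resume, PMF.support_pure, Set.mem_singleton_iff] at h
      exact ⟨t, h ▸ ho'⟩

/-- An attempt is made exactly when all earlier ones fail, so the expected count is the sum of these
probabilities. -/
theorem trialsCost_eq (τ : ℕ → PMF (Option Outcome)) (t N : ℕ) :
    trialsCost τ t N = ENNReal.ofReal (∑ i ∈ Finset.range N, reach τ t i) := by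
  induction N generalizing t with
  | zero => simp [trialsCost]
  | succ N ih =>
    rw [trialsCost, ih, ← ENNReal.ofReal_toReal (PMF.apply_ne_top (τ t) none),
      ← ENNReal.ofReal_mul ENNReal.toReal_nonneg, Finset.sum_range_succ', Finset.mul_sum,
      ENNReal.ofReal_add _ (by simp [reach]), add_comm]
    · simp_rw [reach_succ']
      simp [reach]
    · exact Finset.sum_nonneg fun i _ => Finset.prod_nonneg fun _ _ => ENNReal.toReal_nonneg

end TrialProbability

/-! ### The first success in a sequence of trials -/

section FirstSuccess

variable {E : Type*} [Fintype E] {p : ℕ → E → ℝ}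

/-- The probability that the trials `0, …, i - 1` fail, if trial `s` returns `e` with
probability `p s e`. -/
noncomputable def survive (p : ℕ → E → ℝ) (i : ℕ) : ℝ :=
  ∏ s ∈ Finset.range i, (1 - ∑ e, p s e)

theorem survive_nonneg (hp : ∀ s, ∑ e, p s e ≤ 1) (i : ℕ) : 0 ≤ survive p i :=
  Finset.prod_nonneg fun s _ => sub_nonneg.2 (hp s)

theorem survive_antitone (h0 : ∀ s e, 0 ≤ p s e) (hp : ∀ s, ∑ e, p s e ≤ 1) :
    Antitone (survive p) := by
  refine antitone_nat_of_succ_le fun i => ?_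
  rw [survive, Finset.prod_range_succ]
  refine mul_le_of_le_one_right (survive_nonneg hp i) ?_
  have := Finset.sum_nonneg fun e (_ : e ∈ Finset.univ) => h0 i e
  linarith

theorem survive_le_exp (hp : ∀ s, ∑ e, p s e ≤ 1) (i : ℕ) :
    survive p i ≤ Real.exp (-∑ s ∈ Finset.range i, ∑ e, p s e) := by
  rw [← Finset.sum_neg_distrib, Real.exp_sum]
  refine Finset.prod_le_prod (fun s _ => sub_nonneg.2 (hp s)) fun s _ => ?_
  have := Real.add_one_le_exp (-∑ e, p s e)
  linarith

/-- The sum telescopes: each term is the drop of `survive` at one trial. -/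
theorem sum_survive_mul (i N : ℕ) (h : i ≤ N) :
    ∑ s ∈ Finset.Ico i N, survive p s * ∑ e, p s e = survive p i - survive p N := by
  induction N, h using Nat.le_induction with
  | base => simp
  | succ N hN ih =>
    rw [Finset.sum_Ico_succ_top hN, ih, survive, survive, survive, Finset.prod_range_succ]
    ring

/-- The number of trials up to the first success. -/
theorem sum_survive_le (h0 : ∀ s e, 0 ≤ p s e) (hp : ∀ s, ∑ e, p s e ≤ 1) {i N : ℕ}
    (h : i ≤ N) : ∑ s ∈ Finset.range N, survive p s ≤ i + N * survive p i := by
  have hone : ∀ s, survive p s ≤ 1 := fun s => by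
    simpa [survive] using survive_antitone h0 hp (Nat.zero_le s)
  rw [← Finset.sum_range_add_sum_Ico _ h]
  gcongr
  · calc _ ≤ ∑ s ∈ Finset.range i, (1 : ℝ) := Finset.sum_le_sum fun s _ => hone s
      _ = i := by simp
  · calc _ ≤ ∑ s ∈ Finset.Ico i N, survive p i :=
          Finset.sum_le_sum fun s hs => survive_antitone h0 hp (Finset.mem_Ico.1 hs).1
      _ = (N - i : ℕ) * survive p i := by simp
      _ ≤ _ := by
          gcongr
          · exact survive_nonneg hp i
          · exact Nat.sub_le _ _

/-- If the trials before `i` are almost uniform, and a later one is hardly ever reached, then the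
first success is almost uniform. -/
theorem firstSuccess_close [Nonempty E] (h0 : ∀ s e, 0 ≤ p s e) (hp : ∀ s, ∑ e, p s e ≤ 1)
    {i N : ℕ} (hi : i ≤ N) {ε : ℝ} (hε : 0 < ε) (hε1 : ε < 1) (u : ℕ → ℝ)
    (hup : ∀ s < i, ∀ e, p s e ≤ u s) (hlow : ∀ s < i, ∀ e, (1 - ε / 4) * u s ≤ p s e)
    (hsmall : survive p N ≤ 1 / 4)
    (hδ : survive p i - survive p N ≤ ε / (4 * Fintype.card E)) (e : E) :
    |(∑ s ∈ Finset.range N, survive p s * p s e) / (1 - survive p N) - 1 / Fintype.card E|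
      ≤ ε * (1 / Fintype.card E) := by
  set m : ℝ := (Fintype.card E : ℝ) with hm
  have hmpos : 0 < m := by rw [hm]; exact_mod_cast Fintype.card_pos
  set S : ℝ := ∑ s ∈ Finset.range i, survive p s * u s with hS
  have hnn := survive_nonneg hp
  set β := survive p i - survive p N with hβ
  have hβ0 : 0 ≤ β := sub_nonneg.2 (survive_antitone h0 hp hi)
  have hgood_up : ∀ e, ∑ s ∈ Finset.range i, survive p s * p s e ≤ S := fun e =>
    Finset.sum_le_sum fun s hs =>
      mul_le_mul_of_nonneg_left (hup s (Finset.mem_range.1 hs) e) (hnn s)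
  have hgood_low : ∀ e, (1 - ε / 4) * S ≤ ∑ s ∈ Finset.range i, survive p s * p s e := fun e => by
    rw [hS, Finset.mul_sum]
    refine Finset.sum_le_sum fun s hs => ?_
    rw [mul_left_comm]
    exact mul_le_mul_of_nonneg_left (hlow s (Finset.mem_range.1 hs) e) (hnn s)
  have hbad0 : 0 ≤ ∑ s ∈ Finset.Ico i N, survive p s * p s e :=
    Finset.sum_nonneg fun s _ => mul_nonneg (hnn s) (h0 s e)
  -- `β` is the probability that the first success is a late trial, which bounds the late
  -- contribution to any single `e`.
  have hbad : ∑ s ∈ Finset.Ico i N, survive p s * p s e ≤ β := by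
    rw [hβ, ← sum_survive_mul i N hi]
    refine Finset.sum_le_sum fun s _ => mul_le_mul_of_nonneg_left ?_ (hnn s)
    exact Finset.single_le_sum (fun e _ => h0 s e) (Finset.mem_univ e)
  have htot : ∑ e, ∑ s ∈ Finset.range i, survive p s * p s e = 1 - survive p i := by
    rw [Finset.sum_comm]
    simp_rw [← Finset.mul_sum]
    have := sum_survive_mul (p := p) 0 i (Nat.zero_le i)
    rw [← Finset.range_eq_Ico] at this
    rw [this]
    simp [survive]
  -- Summing the bounds over all `e` ties the unknown normalization `m * S` to the probability of an
  -- early success.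
  have hup' : 1 - survive p i ≤ m * S := by
    rw [← htot, hm, ← nsmul_eq_mul, ← Finset.card_univ, ← Finset.sum_const]
    exact Finset.sum_le_sum fun e _ => hgood_up e
  have hlow' : m * ((1 - ε / 4) * S) ≤ 1 - survive p i := by
    rw [← htot, hm, ← nsmul_eq_mul, ← Finset.card_univ, ← Finset.sum_const]
    exact Finset.sum_le_sum fun e _ => hgood_low e
  rw [← Finset.sum_range_add_sum_Ico _ hi]
  set a := ∑ s ∈ Finset.range i, survive p s * p s e
  set b := ∑ s ∈ Finset.Ico i N, survive p s * p s e
  have ha1 := hgood_up e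
  have ha2 := hgood_low e
  set ρ := 1 - survive p N with hρ
  have hρ' : 3 / 4 ≤ ρ := by linarith
  have hρi : 1 - survive p i = ρ - β := by rw [hρ, hβ]; ring
  rw [hρi] at hup' hlow'
  have hβm : m * β ≤ ε / 4 := by
    calc m * β ≤ m * (ε / (4 * m)) := by gcongr
      _ = ε / 4 := by field_simp
  have hm1 : 1 ≤ m := by rw [hm]; exact_mod_cast Fintype.card_pos
  have hβε : β ≤ ε / 4 := by nlinarith
  have hS0 : 0 ≤ m * S := by linarith
  rw [abs_le]
  have key : (a + b) / ρ - 1 / m = (m * (a + b) - ρ) / (ρ * m) := by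
    field_simp
  have hε' : ε * (1 / m) = (ε * ρ) / (ρ * m) := by
    field_simp
  rw [key, hε', ← neg_div]
  constructor
  · refine (div_le_div_iff_of_pos_right (by positivity)).2 ?_
    have h1 : (1 - ε / 4) * (ρ - β) ≤ (1 - ε / 4) * (m * S) :=
      mul_le_mul_of_nonneg_left hup' (by linarith)
    have h2 : m * ((1 - ε / 4) * S) ≤ m * a := mul_le_mul_of_nonneg_left ha2 hmpos.le
    have h3 : 0 ≤ m * b := mul_nonneg hmpos.le hbad0
    nlinarith
  · refine (div_le_div_iff_of_pos_right (by positivity)).2 ?_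
    have h1 : (1 - ε / 4) * (m * S) ≤ ρ := by linarith
    have h2 : m * a ≤ m * S := mul_le_mul_of_nonneg_left ha1 hmpos.le
    have h3 : m * b ≤ m * β := mul_le_mul_of_nonneg_left hbad hmpos.le
    -- This is `1 / (1 - ε/4) ≤ 1 + ε/2`; the remaining `ε/2` of the budget absorbs `m * β ≤ ε/4`,
    -- since `ρ ≥ 3/4`.
    have h4 : m * S ≤ ρ * (1 + ε / 2) := by
      have h5 : (1 - ε / 4) * (m * S) ≤ (1 - ε / 4) * (ρ * (1 + ε / 2)) := by
        have h6 : 0 ≤ ρ * (ε * (2 - ε)) := by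
          have : 0 < 2 - ε := by linarith
          positivity
        nlinarith only [h1, h6]
      exact le_of_mul_le_mul_left h5 (by linarith)
    nlinarith

end FirstSuccess

/-! ### The parameters of the program -/

section Parameters

/-- The number of attempts for which the degree threshold of the program is high enough. -/
def goodTrials (n L k m : ℕ) : ℕ :=
  Nat.sqrt (n ^ 2 * L ^ 2 * k / (4 * m))

variable {n L k m : ℕ}

theorem four_mul_sq_le {t : ℕ} (hm : 0 < m) (ht : t ≤ goodTrials n L k m) :
    4 * m * t ^ 2 ≤ n ^ 2 * L ^ 2 * k := by
  have h1 : t ^ 2 ≤ n ^ 2 * L ^ 2 * k / (4 * m) := Nat.le_sqrt'.1 ht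
  have h2 := (Nat.le_div_iff_mul_le (by omega)).1 h1
  linarith

theorem lt_four_mul_sq (hm : 0 < m) :
    n ^ 2 * L ^ 2 * k < 4 * m * (goodTrials n L k m + 1) ^ 2 := by
  have h1 : n ^ 2 * L ^ 2 * k / (4 * m) < (goodTrials n L k m + 1) ^ 2 := Nat.lt_succ_sqrt' _
  have h2 := (Nat.div_lt_iff_lt_mul (by omega : 0 < 4 * m)).1 h1
  linarith

theorem goodTrials_pos (hm : 0 < m) (hmn : m ≤ n ^ 2) (hL : 2 ≤ L) (hk : 0 < k) :
    0 < goodTrials n L k m := by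
  refine Nat.sqrt_pos.2 (Nat.div_pos ?_ (by omega))
  calc 4 * m ≤ 2 ^ 2 * n ^ 2 := by omega
    _ ≤ L ^ 2 * n ^ 2 := by gcongr
    _ = n ^ 2 * L ^ 2 * 1 := by ring
    _ ≤ _ := by gcongr; omega

/-- The cap `k ≤ n²` ensures that the `n²L` attempts of the program, a number chosen without knowing
`m`, include all good ones. -/
theorem goodTrials_le (hm : 0 < m) (hk : k ≤ n * n) : goodTrials n L k m ≤ n * n * L := by
  have h := four_mul_sq_le (n := n) (L := L) (k := k) hm le_rfl
  refine (Nat.pow_le_pow_iff_left (n := 2) (by norm_num)).1 ?_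
  calc goodTrials n L k m ^ 2 ≤ 4 * m * goodTrials n L k m ^ 2 :=
        Nat.le_mul_of_pos_left _ (by omega)
    _ ≤ n ^ 2 * L ^ 2 * k := h
    _ ≤ n ^ 2 * L ^ 2 * (n * n) := by gcongr
    _ = _ := by ring

/-- The rounded threshold plus one exceeds `nLk / t`, whose square is at least `4km` by
`four_mul_sq_le`. -/
theorem four_mul_le_threshold_sq {t : ℕ} (hm : 0 < m) (ht0 : 0 < t)
    (ht : t ≤ goodTrials n L k m) : 4 * k * m ≤ (n * L * k / t + 1) ^ 2 := by
  have h1 := four_mul_sq_le hm ht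
  have h2 : n * L * k ≤ (n * L * k / t + 1) * t := by
    have := Nat.div_add_mod (n * L * k) t
    have := Nat.mod_lt (n * L * k) ht0
    nlinarith
  refine Nat.le_of_mul_le_mul_right (c := t ^ 2) ?_ (by positivity)
  calc 4 * k * m * t ^ 2 = k * (4 * m * t ^ 2) := by ring
    _ ≤ k * (n ^ 2 * L ^ 2 * k) := by gcongr
    _ = (n * L * k) ^ 2 := by ring
    _ ≤ ((n * L * k / t + 1) * t) ^ 2 := by gcongr
    _ = _ := by ring

theorem threshold_pos {t : ℕ} (hm : 0 < m) (ht0 : 0 < t) (hk : 0 < k)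
    (ht : t ≤ goodTrials n L k m) : 0 < n * L * k / t := by
  by_contra h
  have h1 := four_mul_le_threshold_sq hm ht0 ht
  rw [Nat.eq_zero_of_not_pos h] at h1
  have : 0 < k * m := Nat.mul_pos hk hm
  nlinarith

theorem sum_range_succ_cast (N : ℕ) :
    ∑ s ∈ Finset.range N, ((s : ℝ) + 1) = N * (N + 1) / 2 := by
  induction N with
  | zero => simp
  | succ N ih => rw [Finset.sum_range_succ, ih]; push_cast; ring

/-- The attempts up to `goodTrials` succeed almost surely. -/
theorem le_sum_of_goodTrials (hn : 0 < n) (hm : 0 < m) (hmn : m ≤ n ^ 2) (hL : 2 ≤ L)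
    (hk : 0 < k) {f : ℕ → ℝ}
    (hf : ∀ s < goodTrials n L k m,
      m * ((1 - 1 / 4) / (2 * n * (n * L * k / (s + 1) : ℕ))) ≤ f s) :
    3 * L / 128 ≤ ∑ s ∈ Finset.range (goodTrials n L k m), f s := by
  have hT := goodTrials_pos hm hmn hL hk
  have hsq : (n : ℝ) ^ 2 * L ^ 2 * k < 4 * m * (goodTrials n L k m + 1) ^ 2 := by
    exact_mod_cast lt_four_mul_sq (n := n) (L := L) (k := k) hm
  have hpos := fun s (hs : s < goodTrials n L k m) =>
    threshold_pos (t := s + 1) hm (by omega) hk hs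
  set T := goodTrials n L k m
  have hn' : (0 : ℝ) < n := by exact_mod_cast hn
  have hm' : (0 : ℝ) < m := by exact_mod_cast hm
  have hL' : (0 : ℝ) < L := by exact_mod_cast (by omega : 0 < L)
  have hk' : (0 : ℝ) < k := by exact_mod_cast hk
  have hT' : (1 : ℝ) ≤ T := by exact_mod_cast hT
  -- Rounding the threshold down only helps, and the resulting bound is linear in the attempt
  -- number; hence the quadratic growth of the sum.
  have hf' : ∀ s ∈ Finset.range T, 3 * m / (8 * n * (n * L * k)) * ((s : ℝ) + 1) ≤ f s := by
    intro s hs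
    refine le_trans ?_ (hf s (Finset.mem_range.1 hs))
    have h1 : (0 : ℝ) < (n * L * k / (s + 1) : ℕ) := by
      exact_mod_cast hpos s (Finset.mem_range.1 hs)
    have h2 : ((n * L * k / (s + 1) : ℕ) : ℝ) * (s + 1) ≤ n * L * k := by
      exact_mod_cast Nat.div_mul_le_self (n * L * k) (s + 1)
    rw [div_mul_eq_mul_div, ← mul_div_assoc, div_le_div_iff₀ (by positivity) (by positivity)]
    have h3 : 0 ≤ 6 * (m : ℝ) * n := by positivity
    nlinarith [mul_le_mul_of_nonneg_left h2 h3]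
  refine le_trans ?_ (Finset.sum_le_sum hf')
  rw [← Finset.mul_sum, sum_range_succ_cast, div_mul_eq_mul_div,
    div_le_div_iff₀ (by norm_num) (by positivity)]
  have h4 : (n : ℝ) ^ 2 * L ^ 2 * k ≤ 8 * m * (T * (T + 1)) := by
    have h5 : ((T : ℝ) + 1) ^ 2 ≤ 2 * (T * (T + 1)) := by nlinarith
    have h6 := mul_le_mul_of_nonneg_left h5 (by positivity : 0 ≤ 4 * (m : ℝ))
    linarith
  nlinarith

/-- The factor `256` in `L` makes the exponent `6 * Nat.clog 2 n`. -/
theorem exp_neg_clog_le (hn : 0 < n) :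
    Real.exp (-(3 * (256 * Nat.clog 2 n : ℕ) / 128)) ≤ 1 / (n : ℝ) ^ 6 := by
  have h1 : (n : ℝ) ≤ 2 ^ Nat.clog 2 n := by exact_mod_cast Nat.le_pow_clog one_lt_two n
  have hn' : (0 : ℝ) < n := by exact_mod_cast hn
  rw [Real.exp_neg, ← one_div]
  refine one_div_le_one_div_of_le (by positivity) ?_
  calc (n : ℝ) ^ 6 ≤ (2 ^ Nat.clog 2 n) ^ 6 := by gcongr
    _ ≤ (Real.exp 1 ^ Nat.clog 2 n) ^ 6 := by
        gcongr
        have := Real.add_one_le_exp 1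
        linarith
    _ = _ := by
        rw [← pow_mul, ← Real.exp_nat_mul]
        congr 1
        push_cast
        ring

theorem clog_le_log (hn : 2 ≤ n) : (Nat.clog 2 n : ℝ) ≤ 3 * Real.log n := by
  have h0 : 0 < Nat.clog 2 n := Nat.clog_pos one_lt_two hn
  have h1 : 2 ^ (Nat.clog 2 n - 1) < n := Nat.pow_pred_clog_lt_self one_lt_two hn
  have h2 : ((Nat.clog 2 n - 1 : ℕ) : ℝ) * Real.log 2 ≤ Real.log n := by
    rw [← Real.log_pow]
    exact Real.log_le_log (by positivity) (by exact_mod_cast h1.le)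
  rw [Nat.cast_sub h0] at h2
  have h3 : Real.log 2 ≤ Real.log n :=
    Real.log_le_log (by norm_num) (by exact_mod_cast hn)
  have h4 := Real.log_two_gt_d9
  push_cast at h2
  have h5 : (0 : ℝ) ≤ Nat.clog 2 n := Nat.cast_nonneg _
  nlinarith

theorem queries_bound (hn : 2 ≤ n) (hm : 0 < m) (hmn : m ≤ n ^ 2) {ε : ℝ} (hε : 0 < ε)
    (hε1 : ε < 1) (hk : (k : ℝ) ≤ 2 / ε) {δ : ℝ} (hδ : δ ≤ 1 / (n : ℝ) ^ 6) :
    1 + (Nat.clog 2 n : ℝ) + 5 * (goodTrials n (256 * Nat.clog 2 n) k m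
      + (n * n * (256 * Nat.clog 2 n) : ℕ) * δ)
      ≤ 3000 * (n / √(ε * m)) * Real.log n ^ 1 := by
  have hm' : (0 : ℝ) < m := by exact_mod_cast hm
  have hn' : (2 : ℝ) ≤ n := by exact_mod_cast hn
  have hmn' : (m : ℝ) ≤ n ^ 2 := by exact_mod_cast hmn
  have hlog := clog_le_log hn
  have hl1 : (1 : ℝ) ≤ Nat.clog 2 n := by exact_mod_cast Nat.clog_pos one_lt_two hn
  set l : ℝ := (Nat.clog 2 n : ℝ) with hl
  set X : ℝ := n / √(ε * m) with hX
  have hs : 0 < √(ε * m) := Real.sqrt_pos.2 (by positivity)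
  have hX1 : 1 ≤ X := by
    rw [hX, one_le_div hs]
    refine Real.sqrt_le_iff.2 ⟨by positivity, ?_⟩
    nlinarith
  have hX2 : X ^ 2 = n ^ 2 / (ε * m) := by
    rw [hX, div_pow, Real.sq_sqrt (by positivity)]
  -- `182` is `256 / √2` rounded up.
  have hT : (goodTrials n (256 * Nat.clog 2 n) k m : ℝ) ≤ 182 * l * X := by
    have h := four_mul_sq_le (n := n) (L := 256 * Nat.clog 2 n) (k := k) hm le_rfl
    have h' : 4 * (m : ℝ) * (goodTrials n (256 * Nat.clog 2 n) k m : ℝ) ^ 2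
        ≤ n ^ 2 * (256 * l) ^ 2 * k := by
      rw [hl]
      exact_mod_cast h
    refine abs_le_of_sq_le_sq' ?_ (by positivity) |>.2
    have h2 : (n : ℝ) ^ 2 * (256 * l) ^ 2 * k ≤ n ^ 2 * (256 * l) ^ 2 * (2 / ε) := by gcongr
    rw [mul_pow, mul_pow, hX2]
    refine le_of_mul_le_mul_left (h'.trans (h2.trans ?_)) (by positivity : 0 < 4 * (m : ℝ))
    rw [← sub_nonneg]
    have : 4 * (m : ℝ) * (182 ^ 2 * l ^ 2 * (n ^ 2 / (ε * m))) - n ^ 2 * (256 * l) ^ 2 * (2 / ε)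
        = 1424 * (l ^ 2 * n ^ 2 / ε) := by
      field_simp
      ring
    rw [this]
    positivity
  have hN : ((n * n * (256 * Nat.clog 2 n) : ℕ) : ℝ) * δ ≤ 16 * l := by
    calc ((n * n * (256 * Nat.clog 2 n) : ℕ) : ℝ) * δ
        ≤ ((n * n * (256 * Nat.clog 2 n) : ℕ) : ℝ) * (1 / (n : ℝ) ^ 6) := by gcongr
      _ = 256 * l / (n : ℝ) ^ 4 := by
          rw [hl]
          push_cast
          field_simp
      _ ≤ 256 * l / 2 ^ 4 := by gcongr
      _ = 16 * l := by ring
  have hlX : l ≤ l * X := le_mul_of_one_le_right (by linarith) hX1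
  rw [pow_one]
  have hfin : l * X ≤ 3 * Real.log n * X := by gcongr
  -- With `1 ≤ l ≤ l * X` the total is at most `(2 + 5 * (182 + 16)) * (l * X) = 992 * (l * X)`, and
  -- `l ≤ 3 * log n`.
  nlinarith

end Parameters

/-! ### Weighted edges -/

section Weights

variable {Ω : Type*} [Fintype Ω] {ε : ℝ} {P : Ω → ℝ}

theorem PointwiseClose.abs_expect_sub_le {Q : Ω → ℝ} (h : PointwiseClose ε P Q) (w : Ω → ℝ) :
    |expect P w - expect Q w| ≤ ε * expect Q fun x => |w x| := by
  simp only [expect]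
  rw [← Finset.sum_sub_distrib, Finset.mul_sum]
  refine (Finset.abs_sum_le_sum_abs _ _).trans (Finset.sum_le_sum fun x _ => ?_)
  rw [← sub_mul, abs_mul, ← mul_assoc]
  exact mul_le_mul_of_nonneg_right (h x) (abs_nonneg _)

theorem expect_abs_of_sign {Q : Ω → ℝ} (hQ : ∀ x, 0 ≤ Q x) {w : Ω → ℝ}
    (hw : (∀ x, 0 ≤ w x) ∨ ∀ x, w x ≤ 0) : (expect Q fun x => |w x|) = |expect Q w| := by
  simp only [expect]
  rcases hw with hw | hw
  · rw [abs_of_nonneg (Finset.sum_nonneg fun x _ => mul_nonneg (hQ x) (hw x))]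
    exact Finset.sum_congr rfl fun x _ => by rw [abs_of_nonneg (hw x)]
  · rw [abs_of_nonpos (Finset.sum_nonpos fun x _ => mul_nonpos_of_nonneg_of_nonpos (hQ x) (hw x)),
      ← Finset.sum_neg_distrib]
    exact Finset.sum_congr rfl fun x _ => by rw [abs_of_nonpos (hw x), mul_neg]

end Weights

/-! ### Almost uniform sampling -/

section Sampling

variable {n : ℕ} {G : SimpleGraph (Fin n)} [DecidableRel G.Adj] (nbr : NeighborOrder G)

/-- The probability that attempt number `s` of the program returns the edge `e`. -/
noncomputable def attemptProb (L k s : ℕ) (e : G.Dart) : ℝ :=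
  dartProb nbr (n * L * k / (s + 1)) e

variable {nbr}

theorem attemptProb_nonneg (L k s : ℕ) (e : G.Dart) : 0 ≤ attemptProb nbr L k s e :=
  ENNReal.toReal_nonneg

theorem sum_attemptProb_le (hn : 0 < n) (L k s : ℕ) : ∑ e, attemptProb nbr L k s e ≤ 1 := by
  have h := trialLaw_apply_none (G := G) (nbr := nbr) (θ := n * L * k / (s + 1)) hn
  have : 0 ≤ (trialLaw G nbr (n * L * k / (s + 1)) none).toReal := ENNReal.toReal_nonneg
  simp only [attemptProb]
  linarith

theorem reach_eq_survive (hn : 0 < n) (L k i : ℕ) :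
    reach (fun s => trialLaw G nbr (n * L * k / (s + 1))) 0 i
      = survive (attemptProb nbr L k) i := by
  refine Finset.prod_congr rfl fun s _ => ?_
  rw [zero_add]
  exact trialLaw_apply_none hn

theorem trialsLaw_pair (hn : 0 < n) (L k N : ℕ) (e : G.Dart) :
    (trialsLaw (fun s => trialLaw G nbr (n * L * k / (s + 1))) 0 N (.pair e.fst e.snd)).toReal
      = ∑ s ∈ Finset.range N, survive (attemptProb nbr L k) s * attemptProb nbr L k s e := by
  rw [trialsLaw_apply _ _ _ (by simp)]
  refine Finset.sum_congr rfl fun s _ => ?_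
  rw [reach_eq_survive hn, zero_add]
  rfl

theorem card_dart_le (G : SimpleGraph (Fin n)) [DecidableRel G.Adj] :
    Fintype.card G.Dart ≤ n ^ 2 := by
  rw [G.dart_card_eq_sum_degrees]
  calc ∑ v, G.degree v ≤ ∑ _v : Fin n, n :=
        Finset.sum_le_sum fun v _ => by simpa using (G.degree_lt_card_verts v).le
    _ = n ^ 2 := by simp [sq]

variable {L k : ℕ}

/-- For the success probability a crude bias bound `η = 1/4` suffices, so this does not depend on
`ε`. -/
theorem survive_goodTrials_le (hn : 0 < n) (hm : 0 < Fintype.card G.Dart) (hL : 2 ≤ L)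
    (hk : 0 < k) :
    survive (attemptProb nbr L k) (goodTrials n L k (Fintype.card G.Dart))
      ≤ Real.exp (-(3 * L / 128)) := by
  refine (survive_le_exp (sum_attemptProb_le hn L k) _).trans ?_
  rw [Real.exp_le_exp, neg_le_neg_iff]
  refine le_sum_of_goodTrials hn hm (card_dart_le G) hL hk fun s hs => ?_
  have hθ := threshold_pos (t := s + 1) hm (by omega) hk hs
  have hsq := four_mul_le_threshold_sq (t := s + 1) hm (by omega) hs
  have hm4 : (Fintype.card G.Dart : ℝ) ≤ 1 / 4 * ((n * L * k / (s + 1) : ℕ) + 1) ^ 2 := by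
    have h1 : 4 * Fintype.card G.Dart ≤ 4 * k * Fintype.card G.Dart :=
      Nat.mul_le_mul_right _ (by omega)
    have h2 : 4 * (Fintype.card G.Dart : ℝ) ≤ ((n * L * k / (s + 1) : ℕ) + 1) ^ 2 := by
      exact_mod_cast h1.trans hsq
    linarith
  rw [← nsmul_eq_mul, ← Finset.card_univ, ← Finset.sum_const]
  exact Finset.sum_le_sum fun e _ => le_dartProb hn hθ (by norm_num) (.inl hm4) e

/-- The law of the returned edge is almost uniform. -/
theorem attempts_close (hn : 2 ≤ n) (hm : 0 < Fintype.card G.Dart) {ε : ℝ} (hε : 0 < ε)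
    (hε1 : ε < 1) (hL : 2 ≤ L) (hk : 0 < k) (hkε : 1 / ε ≤ k)
    (hδ : Real.exp (-(3 * L / 128)) ≤ 1 / (n : ℝ) ^ 6) (e : G.Dart) :
    |(∑ s ∈ Finset.range (n * n * L), survive (attemptProb nbr L (min k (n * n))) s
        * attemptProb nbr L (min k (n * n)) s e)
        / (1 - survive (attemptProb nbr L (min k (n * n))) (n * n * L))
      - 1 / Fintype.card G.Dart| ≤ ε * (1 / Fintype.card G.Dart) := by
  have : Nonempty G.Dart := ⟨e⟩
  have hn0 : 0 < n := by omega
  have hn' : (2 : ℝ) ≤ n := by exact_mod_cast hn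
  have hk' : 0 < min k (n * n) := lt_min hk (by positivity)
  have hm' : (0 : ℝ) < Fintype.card G.Dart := by exact_mod_cast hm
  have hmn : (Fintype.card G.Dart : ℝ) ≤ (n : ℝ) ^ 2 := by exact_mod_cast card_dart_le G
  have h0 := attemptProb_nonneg (nbr := nbr) L (min k (n * n))
  have hp := sum_attemptProb_le (nbr := nbr) hn0 L (min k (n * n))
  have hT := goodTrials_le (n := n) (L := L) hm (min_le_right k (n * n))
  have hδT := (survive_goodTrials_le (nbr := nbr) hn0 hm hL hk').trans hδ
  have hanti := survive_antitone h0 hp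
  have hsmall : survive (attemptProb nbr L (min k (n * n))) (n * n * L) ≤ 1 / 4 := by
    refine (hanti hT).trans (hδT.trans ?_)
    refine one_div_le_one_div_of_le (by norm_num) ?_
    calc (4 : ℝ) ≤ 2 ^ 6 := by norm_num
      _ ≤ (n : ℝ) ^ 6 := by gcongr
  -- If the cap is inactive, `εn² ≥ 1`, so the failure bound `n⁻⁶` is below `ε / (4m)` and
  -- `goodTrials` separates early from late. Otherwise `ε` may be arbitrarily small and exactness is
  -- needed.
  rcases le_or_gt k (n * n) with hkn | hkn
  · rw [min_eq_left hkn] at *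
    have hkn' : (k : ℝ) ≤ (n : ℝ) ^ 2 := by
      rw [sq]
      exact_mod_cast hkn
    have hk0 : (0 : ℝ) < k := by exact_mod_cast hk
    have hεk : 1 ≤ ε * k := by
      rwa [div_le_iff₀' hε] at hkε
    refine firstSuccess_close h0 hp hT hε hε1
      (fun s => 1 / (2 * n * (n * L * k / (s + 1) : ℕ))) (fun s hs e => ?_) (fun s hs e => ?_)
      hsmall ?_ e
    · exact dartProb_le hn0 (threshold_pos hm (by omega) hk hs) e
    -- The bias is `η = ε/4`: here `4km ≤ (θ + 1) ^ 2` and `1 ≤ εk`.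
    · have hsq := four_mul_le_threshold_sq (t := s + 1) hm (by omega) hs
      rw [mul_one_div]
      refine le_dartProb hn0 (threshold_pos hm (by omega) hk hs) (by positivity) (.inl ?_) e
      have h1 : 4 * (k : ℝ) * Fintype.card G.Dart
          ≤ ((n * L * k / (s + 1) : ℕ) + 1) ^ 2 := by
        exact_mod_cast hsq
      have h2 := mul_le_mul_of_nonneg_left h1 hε.le
      have h3 := mul_le_mul_of_nonneg_right hεk hm'.le
      linarith
    · have hN := survive_nonneg hp (n * n * L)
      have h1 : 1 / (n : ℝ) ^ 6 ≤ ε / (4 * Fintype.card G.Dart) := by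
        rw [div_le_div_iff₀ (by positivity) (by positivity)]
        have h2 : 1 ≤ ε * (n : ℝ) ^ 2 := hεk.trans (by gcongr)
        have h3 : (4 : ℝ) ≤ n ^ 2 := by nlinarith
        calc 1 * (4 * (Fintype.card G.Dart : ℝ)) ≤ 1 * ((n : ℝ) ^ 2 * n ^ 2) := by gcongr
          _ ≤ (ε * (n : ℝ) ^ 2) * ((n : ℝ) ^ 2 * n ^ 2) := by gcongr
          _ = ε * (n : ℝ) ^ 6 := by ring
      linarith
  · rw [min_eq_right hkn.le] at *
    -- With `k` replaced by `n²`, no threshold in use falls below `n`; all attempts are good and the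
    -- late part is empty.
    have hθ : ∀ s < n * n * L, n ≤ n * L * (n * n) / (s + 1) := by
      intro s hs
      rw [Nat.le_div_iff_mul_le (by omega)]
      calc n * (s + 1) ≤ n * (n * n * L) := Nat.mul_le_mul_left _ hs
        _ = _ := by ring
    refine firstSuccess_close h0 hp le_rfl hε hε1
      (fun s => 1 / (2 * n * (n * L * (n * n) / (s + 1) : ℕ))) (fun s hs e => ?_)
      (fun s hs e => ?_) hsmall ?_ e
    · exact dartProb_le hn0 (hn0.trans_le (hθ s hs)) e
    · rw [mul_one_div]
      exact le_dartProb hn0 (hn0.trans_le (hθ s hs)) (by positivity) (.inr (hθ s hs)) e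
    · rw [sub_self]
      positivity

end Sampling

end EdgeSampling

/-! ### The main theorem -/

open EdgeSampling in
theorem corollary3 :
    -- a program, its word-size exponent, and the constants of the query and time bounds
    ∃ (A : Cmd) (b : ℕ) (C : ℝ) (a : ℕ) (c : ℕ),
      ∀ (n : ℕ) (G : SimpleGraph (Fin n)) [DecidableRel G.Adj] (nbr : NeighborOrder G) (ε : ℝ),
        0 < ε → ε < 1 → 0 < Fintype.card G.Dart →
        -- every run halts with probability one and returns an edge or "fail"
        (∑' o, outcomeProb (env G nbr ε b) A o = 1) ∧
        (∀ u v : ℕ, outcomeProb (env G nbr ε b) A (.pair u v) ≠ 0 →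
          ∃ e : G.Dart, (e.fst : ℕ) = u ∧ (e.snd : ℕ) = v) ∧
        -- expected number of queries
        expectedQueries (env G nbr ε b) A ≤
          ENNReal.ofReal
            (C * ((n : ℝ) / √(ε * (Fintype.card G.Dart : ℝ))) * Real.log n ^ a) ∧
        -- the running time is linear in the number of queries
        (∀ T, ∀ s ∈ (runFor (env G nbr ε b) A T).support,
          s.out.isSome → s.steps ≤ c * s.queries) ∧
        -- success probability and pointwise closeness
        2 / 3 ≤ successProb (env G nbr ε b) A ∧
        PointwiseClose ε (edgeDist (env G nbr ε b) A) (unif G.Dart) ∧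
        -- weighted edges
        ∀ w : G.Dart → ℝ,
          |expect (edgeDist (env G nbr ε b) A) w - expect (unif G.Dart) w| ≤
            ε * expect (unif G.Dart) (fun e => |w e|) ∧
          ((∀ e, 0 ≤ w e) ∨ (∀ e, w e ≤ 0) →
            |expect (edgeDist (env G nbr ε b) A) w - expect (unif G.Dart) w| ≤
              ε * |expect (unif G.Dart) w|) := by
  refine ⟨Program.sampler, 12, 3000, 1, 101, ?_⟩
  intro n G _ nbr ε hε hε1 hm
  obtain ⟨e₀⟩ : Nonempty G.Dart := Fintype.card_pos_iff.1 hm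
  have hn : 2 ≤ n := by
    have h1 := e₀.fst.2
    have h2 := e₀.snd.2
    have h3 := Fin.val_ne_of_ne e₀.fst_ne_snd
    omega
  have hn0 : 0 < n := by omega
  have hk2 : 2 ≤ ⌈1 / ε⌉₊ :=
    Nat.lt_ceil.2 (by rw [Nat.cast_one, lt_div_iff₀ hε]; linarith)
  have hkε : 1 / ε ≤ ⌈1 / ε⌉₊ := Nat.le_ceil _
  have hkε' : ((min ⌈1 / ε⌉₊ (n * n) : ℕ) : ℝ) ≤ 2 / ε := by
    have h1 := Nat.ceil_lt_add_one (by positivity : 0 ≤ 1 / ε)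
    have h2 : 1 ≤ 1 / ε := by rw [le_div_iff₀ hε]; linarith
    have h3 : ((min ⌈1 / ε⌉₊ (n * n) : ℕ) : ℝ) ≤ ⌈1 / ε⌉₊ := by exact_mod_cast min_le_left _ _
    have h4 : 2 / ε = 1 / ε + 1 / ε := by ring
    linarith
  have hspec := spec_sampler (I := env G nbr ε 12) le_rfl hn hk2 rfl
  have hδ := exp_neg_clog_le hn0
  have hL : 2 ≤ 256 * Nat.clog 2 n := by
    have := Nat.clog_pos one_lt_two hn
    omega
  -- Unfolds the input `k` of `env` to `⌈1 / ε⌉₊`, so that the terms match the lemmas on attempts.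
  change Spec (env G nbr ε 12) _ _ (Config.init Program.sampler n (env G nbr ε 12).k).regs _ _
    (trialsLaw (fun s => trialLaw G nbr
      (n * (256 * Nat.clog 2 n) * min ⌈1 / ε⌉₊ (n * n) / (s + 1))) 0 _)
    (5 * trialsCost (fun s => trialLaw G nbr
      (n * (256 * Nat.clog 2 n) * min ⌈1 / ε⌉₊ (n * n) / (s + 1))) 0 _) at hspec
  have hret : ∀ e : G.Dart, returnProb (env G nbr ε 12) Program.sampler e = _ := fun e =>
    (congrArg ENNReal.toReal (outcomeProb_eq hspec _)).trans (trialsLaw_pair hn0 _ _ _ e)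
  have hk' : 0 < min ⌈1 / ε⌉₊ (n * n) := lt_min (by omega) (by positivity)
  have hT := goodTrials_le (n := n) (L := 256 * Nat.clog 2 n) hm (min_le_right ⌈1 / ε⌉₊ (n * n))
  have hδT := (survive_goodTrials_le (nbr := nbr) hn0 hm hL hk').trans hδ
  have hclose := attempts_close (nbr := nbr) hn hm hε hε1 hL (by omega) hkε hδ
  set L := 256 * Nat.clog 2 n with hLdef
  set k := min ⌈1 / ε⌉₊ (n * n)
  have h0 := attemptProb_nonneg (nbr := nbr) L k
  have hp := sum_attemptProb_le (nbr := nbr) hn0 L k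
  have hsucc : successProb (env G nbr ε 12) Program.sampler
      = 1 - survive (attemptProb nbr L k) (n * n * L) := by
    rw [successProb]
    simp_rw [hret]
    rw [Finset.sum_comm]
    simp_rw [← Finset.mul_sum]
    rw [Finset.range_eq_Ico, sum_survive_mul 0 _ (Nat.zero_le _)]
    simp [survive]
  have hpc : PointwiseClose ε (edgeDist (env G nbr ε 12) Program.sampler) (unif G.Dart) := by
    intro e
    rw [edgeDist, hsucc, hret]
    exact hclose e
  refine ⟨?_, ?_, ?_, ?_, ?_, hpc, fun w => ⟨hpc.abs_expect_sub_le w, fun hw => ?_⟩⟩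
  · simp_rw [outcomeProb_eq hspec]
    exact PMF.tsum_coe _
  · intro u v h
    rw [outcomeProb_eq hspec] at h
    obtain ⟨s, hs⟩ := mem_support_trialsLaw (by simp) ((PMF.mem_support_iff _ _).2 h)
    obtain ⟨e, he⟩ := exists_dart_of_mem_trialLaw hn0 hs
    simp only [Outcome.pair.injEq] at he
    exact ⟨e, he.1.symm, he.2.symm⟩
  · refine (expectedQueries_le hspec).trans ?_
    -- Splitting at `goodTrials` bounds the number of attempts by `T` plus `n²L` times the chance
    -- that all good ones fail.
    have hle := sum_survive_le h0 hp hT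
    have hnn : 0 ≤ ∑ s ∈ Finset.range (n * n * L), survive (attemptProb nbr L k) s :=
      Finset.sum_nonneg fun s _ => survive_nonneg hp s
    rw [trialsCost_eq]
    simp_rw [reach_eq_survive hn0]
    rw [← ENNReal.ofReal_natCast, ← ENNReal.ofReal_ofNat, ← ENNReal.ofReal_mul (by norm_num),
      ← ENNReal.ofReal_add (by positivity) (by positivity)]
    have hq := queries_bound hn hm (card_dart_le G) hε hε1 hkε' hδT
    rw [← hLdef] at hq
    refine ENNReal.ofReal_le_ofReal (le_trans ?_ hq)
    rw [Nat.cast_add, Nat.cast_one]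
    linarith
  · intro T s hs ho
    exact steps_le hspec hs ho
  · rw [hsucc]
    have h1 : survive (attemptProb nbr L k) (n * n * L) ≤ 1 / (n : ℝ) ^ 6 :=
      (survive_antitone h0 hp hT).trans hδT
    have h2 : 1 / (n : ℝ) ^ 6 ≤ 1 / 2 ^ 6 := by
      have : (2 : ℝ) ≤ n := by exact_mod_cast hn
      gcongr
    norm_num at h1 h2
    linarith
  · rw [← expect_abs_of_sign (fun _ => by simp only [unif]; positivity) hw]
    exact hpc.abs_expect_sub_le w
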